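/- Let $X \subset \mathbb{P}^n$ be a smooth cubic hypersurface over $\mathbb{C}$ that contains a line $\ell$. Then $X$ admits a unirational parametrization of degree two: there is a dominant rational map $\rho : \mathbb{P}^{n-1} \dashrightarrow X$ of degree two, that is, the function field $\mathbb{C}(\mathbb{P}^{n-1})$ is an extension of degree two of $\rho^*\mathbb{C}(X)$. -/

import Mathlib

open scoped LinearAlgebra.Projectivization

noncomputable section

namespace CubicUnirational

/-- The closed subset of the complex projective space with homogeneous coordinates `x i`, `i : σ`,
on which the form `G` vanishes (for a form, the choice of representative is irrelevant). -/
def zeroLocus {σ : Type} (G : MvPolynomial σ ℂ) : Set (ℙ ℂ (σ → ℂ)) :=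
  {p | MvPolynomial.eval p.rep G = 0}

/-- The Zariski closure of a set of points of a projective space. -/
def zariskiClosure {σ : Type} (S : Set (ℙ ℂ (σ → ℂ))) : Set (ℙ ℂ (σ → ℂ)) :=
  {p | ∀ (d : ℕ) (G : MvPolynomial σ ℂ), G.IsHomogeneous d → S ⊆ zeroLocus G → p ∈ zeroLocus G}

/-- `X ⊆ ℙⁿ` is a smooth cubic hypersurface: it is the zero locus of a cubic form `F` whose
partial derivatives have no common zero on `X`. -/
def IsSmoothCubic {n : ℕ} (X : Set (ℙ ℂ (Fin (n + 1) → ℂ))) : Prop :=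
  ∃ F : MvPolynomial (Fin (n + 1)) ℂ, F.IsHomogeneous 3 ∧ X = zeroLocus F ∧
    ∀ p ∈ X, ∃ i, MvPolynomial.eval p.rep (MvPolynomial.pderiv i F) ≠ 0

/-- A line in `ℙⁿ`: the projectivization of a two-dimensional linear subspace. -/
def IsLine {n : ℕ} (L : Set (ℙ ℂ (Fin (n + 1) → ℂ))) : Prop :=
  ∃ W : Submodule ℂ (Fin (n + 1) → ℂ), Module.finrank ℂ W = 2 ∧ L = {p | p.submodule ≤ W}

/-- The field of all `A(f) / B(f)`, where `A`, `B` are forms of the same degree in variables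
indexed by `τ` with `B(f) ≠ 0`, and `f` is a family of polynomials in variables indexed by `σ`. -/
def ratioField {σ τ : Type} (f : τ → MvPolynomial σ ℂ) :
    IntermediateField ℂ (FractionRing (MvPolynomial σ ℂ)) where
  carrier := {x | ∃ (d : ℕ) (A B : MvPolynomial τ ℂ), A.IsHomogeneous d ∧ B.IsHomogeneous d ∧
    MvPolynomial.aeval f B ≠ 0 ∧
    x = algebraMap _ (FractionRing (MvPolynomial σ ℂ)) (MvPolynomial.aeval f A) /
      algebraMap _ (FractionRing (MvPolynomial σ ℂ)) (MvPolynomial.aeval f B)}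
  mul_mem' := by
    rintro _ _ ⟨d, A, B, hA, hB, hB0, rfl⟩ ⟨d', A', B', hA', hB', hB0', rfl⟩
    refine ⟨d + d', A * A', B * B', hA.mul hA', hB.mul hB', ?_, ?_⟩
    · rw [map_mul]; exact mul_ne_zero hB0 hB0'
    · simp only [map_mul]; rw [div_mul_div_comm]
  add_mem' := by
    rintro _ _ ⟨d, A, B, hA, hB, hB0, rfl⟩ ⟨d', A', B', hA', hB', hB0', rfl⟩
    refine ⟨d + d', A * B' + B * A', B * B', (hA.mul hB').add (hB.mul hA'), hB.mul hB', ?_, ?_⟩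
    · rw [map_mul]; exact mul_ne_zero hB0 hB0'
    · have inj := IsFractionRing.injective (MvPolynomial σ ℂ) (FractionRing (MvPolynomial σ ℂ))
      simp only [map_mul, map_add]
      exact div_add_div _ _ ((map_ne_zero_iff _ inj).2 hB0) ((map_ne_zero_iff _ inj).2 hB0')
  algebraMap_mem' := by
    intro c
    refine ⟨0, MvPolynomial.C c, 1, MvPolynomial.isHomogeneous_C _ _,
      MvPolynomial.isHomogeneous_one _ _, by simp, ?_⟩
    simp [IsScalarTower.algebraMap_apply ℂ (MvPolynomial σ ℂ) (FractionRing (MvPolynomial σ ℂ))]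
  inv_mem' := by
    rintro _ ⟨d, A, B, hA, hB, hB0, rfl⟩
    by_cases h : MvPolynomial.aeval f A = 0
    · exact ⟨0, 0, 1, MvPolynomial.isHomogeneous_zero _ _ _, MvPolynomial.isHomogeneous_one _ _,
        by simp, by rw [h]; simp⟩
    · exact ⟨d, B, A, hB, hA, h, by rw [inv_div]⟩

/-- The function field of the projective space with homogeneous coordinates `y i`, `i : σ`:
all quotients of two forms of the same degree. -/
def functionField (σ : Type) : IntermediateField ℂ (FractionRing (MvPolynomial σ ℂ)) :=
  ratioField (MvPolynomial.X : σ → MvPolynomial σ ℂ)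

theorem mem_functionField {σ : Type} (x : FractionRing (MvPolynomial σ ℂ)) :
    x ∈ functionField σ ↔ ∃ (d : ℕ) (A B : MvPolynomial σ ℂ), A.IsHomogeneous d ∧
      B.IsHomogeneous d ∧ B ≠ 0 ∧ x = algebraMap _ _ A / algebraMap _ _ B := by
  change (∃ (d : ℕ) (A B : MvPolynomial σ ℂ), _) ↔ _
  simp only [MvPolynomial.aeval_X_left, AlgHom.id_apply]

/-- A rational map between the projective spaces with homogeneous coordinates indexed by `σ` and
by `τ`, given by forms of one common degree, not all zero. -/
structure ProjRatMap (σ τ : Type) where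
  deg : ℕ
  form : τ → MvPolynomial σ ℂ
  isHomogeneous : ∀ i, (form i).IsHomogeneous deg
  exists_ne_zero : ∃ i, form i ≠ 0

namespace ProjRatMap

variable {σ τ : Type} (ρ : ProjRatMap σ τ)

/-- The image of the open set on which the given forms do not vanish simultaneously. -/
def image : Set (ℙ ℂ (τ → ℂ)) :=
  {q | ∃ (p : ℙ ℂ (σ → ℂ)) (h : (fun i => MvPolynomial.eval p.rep (ρ.form i)) ≠ 0),
    q = Projectivization.mk ℂ (fun i => MvPolynomial.eval p.rep (ρ.form i)) h}

/-- `ρ` is a dominant rational map to `X`: it takes values in the closed set `X`, and its image is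
Zariski dense in `X`. -/
def IsDominantOnto (X : Set (ℙ ℂ (τ → ℂ))) : Prop :=
  ρ.image ⊆ X ∧ X ⊆ zariskiClosure ρ.image

/-- The subfield `ρ^* ℂ(X)` of the function field of the source, `X` being the closure of the
image of `ρ`: all pullbacks `A(ρ) / B(ρ)` of rational functions `A / B` on `X`. (A form `B`
vanishes identically on `X` exactly when `B(ρ) = 0`.) -/
def pullbackField : IntermediateField ℂ (FractionRing (MvPolynomial σ ℂ)) :=
  ratioField ρ.form

theorem pullbackField_le : ρ.pullbackField ≤ functionField σ := by
  rintro _ ⟨d, A, B, hA, hB, hB0, rfl⟩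
  rw [mem_functionField]
  exact ⟨ρ.deg * d, _, _, hA.aeval _ ρ.isHomogeneous, hB.aeval _ ρ.isHomogeneous, hB0, rfl⟩

/-- The degree of `ρ` as a dominant rational map onto the closure `X` of its image: the degree
`[ℂ(ℙ) : ρ^* ℂ(X)]` of the extension of function fields (`0` if it is infinite). -/
def degree : ℕ :=
  Module.finrank ρ.pullbackField (IntermediateField.extendScalars ρ.pullbackField_le)

end ProjRatMap

end CubicUnirational

end

/-! Let `T` be the symmetric trilinear form with `F x = T x x x`. At a point `p` of the line ℓ, a
line tangent to `X` in direction `d` meets `X` twice at `p` and, in general, in one residual point.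
Pairs `(p, d)` form a rational variety of dimension `1 + (n - 2) = n - 1`, and sending such a pair
to its residual point is the parametrization. A point `x` of `X` comes from `p` exactly when it lies
in the tangent hyperplane at `p`, that is, when `T p p x = 0`. This is a quadratic equation for `p`
on ℓ, which is where degree two comes from.

Coordinates: `B none` is a vector `e` used to project directions into the tangent hyperplane. The
coordinates `y i₀`, `y i₁` give `p`, and the `y i` with `i ≠ i₀` give the direction, so `y i₁`
serves twice and `n` homogeneous coordinates suffice. The resulting forms have degree 10
(`residualPt`).

Degree: the ratio `r = y i₀ / y i₁` generates the function field over the pullback field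
(`IsGeneric.ratio_mem`) and satisfies a quadratic equation (`IsGeneric.ratio_quadratic`). It is not
itself a pullback, since a rational expression for `r` in the image point would take one value on
two preimages with different ratios (`IsGeneric.ratio_ne`). This needs one point `x` with two
nondegenerate preimages. It is found on a smooth conic residual to ℓ in a plane through ℓ, meeting ℓ
in two points (`exists_transversal_plane`, `exists_isGeneric`); smoothness of `X` provides the
plane.

Dominance: the coordinates are algebraic over the ring generated by the parametrizing forms, so that
ring has transcendence degree `n`. As `F` is irreducible, a transcendence degree count shows that
all relations between these forms are multiples of `F` (`dvd_of_aeval_eq_zero`). -/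

noncomputable section

namespace CubicUnirational

open MvPolynomial

/-! ### Polarization of a cubic form -/

section Polarization

variable {ι : Type} [Fintype ι]

/-- The coefficients of the symmetric trilinear form that polarizes a cubic form. -/
def polarCoeff (F : MvPolynomial ι ℂ) (i j k : ι) : ℂ :=
  (1 / 6) * eval 0 (pderiv i (pderiv j (pderiv k F)))

/-- The symmetric trilinear form `T` with `F x = T x x x`, over an arbitrary `ℂ`-algebra. -/
def polar (F : MvPolynomial ι ℂ) (R : Type*) [CommRing R] [Algebra ℂ R] :
    (ι → R) →ₗ[R] (ι → R) →ₗ[R] (ι → R) →ₗ[R] R :=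
  ∑ i, ∑ j, ∑ k, algebraMap ℂ R (polarCoeff F i j k) •
    ((LinearMap.proj i).smulRight ((LinearMap.proj j).smulRight (LinearMap.proj k)))

variable {R S : Type*} [CommRing R] [Algebra ℂ R] [CommRing S] [Algebra ℂ S]

theorem polar_apply (F : MvPolynomial ι ℂ) (x y z : ι → R) :
    polar F R x y z = ∑ i, ∑ j, ∑ k, algebraMap ℂ R (polarCoeff F i j k) * (x i * (y j * z k)) := by
  simp [polar, LinearMap.sum_apply, Algebra.smul_def]

theorem pderiv_pderiv_comm {ι : Type} (F : MvPolynomial ι ℂ) (i j : ι) :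
    pderiv i (pderiv j F) = pderiv j (pderiv i F) := by
  classical
  have h : ⁅pderiv (R := ℂ) i, pderiv (R := ℂ) j⁆ = 0 := by
    refine MvPolynomial.derivation_ext fun k => ?_
    rw [Derivation.commutator_apply]
    simp only [pderiv_X, Derivation.zero_apply]
    rcases eq_or_ne k i with rfl | h1 <;> rcases eq_or_ne k j with rfl | h2 <;>
      simp [*]
  have := congrArg (fun D => D F) h
  simpa [Derivation.commutator_apply, sub_eq_zero] using this

theorem polar_swap₁₂ (F : MvPolynomial ι ℂ) (x y z : ι → R) :
    polar F R x y z = polar F R y x z := by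
  rw [polar_apply, polar_apply, Finset.sum_comm]
  refine Finset.sum_congr rfl fun i _ => Finset.sum_congr rfl fun j _ =>
    Finset.sum_congr rfl fun k _ => ?_
  rw [polarCoeff, pderiv_pderiv_comm, ← polarCoeff]
  ring

theorem polar_swap₂₃ (F : MvPolynomial ι ℂ) (x y z : ι → R) :
    polar F R x y z = polar F R x z y := by
  rw [polar_apply, polar_apply]
  refine Finset.sum_congr rfl fun i _ => ?_
  rw [Finset.sum_comm]
  refine Finset.sum_congr rfl fun j _ => Finset.sum_congr rfl fun k _ => ?_
  rw [polarCoeff, pderiv_pderiv_comm F k j, ← polarCoeff]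
  ring

theorem map_polar (F : MvPolynomial ι ℂ) (f : R →ₐ[ℂ] S) (x y z : ι → R) :
    f (polar F R x y z) = polar F S (fun i => f (x i)) (fun i => f (y i)) (fun i => f (z i)) := by
  simp [polar_apply, map_sum]

theorem isHomogeneous_polar {σ : Type} (F : MvPolynomial ι ℂ) {x y z : ι → MvPolynomial σ ℂ}
    {a b c : ℕ} (hx : ∀ i, (x i).IsHomogeneous a) (hy : ∀ i, (y i).IsHomogeneous b)
    (hz : ∀ i, (z i).IsHomogeneous c) :
    (polar F (MvPolynomial σ ℂ) x y z).IsHomogeneous (a + b + c) := by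
  rw [polar_apply]
  refine IsHomogeneous.sum _ _ _ fun i _ => IsHomogeneous.sum _ _ _ fun j _ =>
    IsHomogeneous.sum _ _ _ fun k _ => ?_
  rw [add_assoc]
  exact ((hx i).mul ((hy j).mul (hz k))).C_mul _

theorem eval_of_isHomogeneous_zero {ι : Type} {G : MvPolynomial ι ℂ} (hG : G.IsHomogeneous 0) (x : ι → ℂ) :
    eval x G = eval 0 G := by
  rw [← totalDegree_zero_iff_isHomogeneous, totalDegree_eq_zero_iff_eq_C] at hG
  rw [hG]; simp

theorem sum_mul_eval_pderiv {G : MvPolynomial ι ℂ} {d : ℕ} (hG : G.IsHomogeneous d) (x : ι → ℂ) :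
    ∑ i, x i * eval x (pderiv i G) = d * eval x G := by
  have := congrArg (eval x) hG.sum_X_mul_pderiv
  simpa using this

/-- Euler's identity is applied to the first and to the second partial derivatives; the third ones
are constants. -/
theorem eval_pderiv_eq_polar [DecidableEq ι] {F : MvPolynomial ι ℂ} (hF : F.IsHomogeneous 3)
    (x : ι → ℂ) (k : ι) :
    eval x (pderiv k F) = 3 * polar F ℂ x x (Pi.single k 1) := by
  have h1 := sum_mul_eval_pderiv (hF.pderiv (i := k)) x
  have h2 : ∀ j, ∑ i, x i * eval x (pderiv i (pderiv j (pderiv k F))) =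
      eval x (pderiv j (pderiv k F)) := fun j => by
    simpa using sum_mul_eval_pderiv ((hF.pderiv (i := k)).pderiv (i := j)) x
  have h3 : ∀ i j, eval x (pderiv i (pderiv j (pderiv k F))) = 6 * polarCoeff F i j k :=
    fun i j => by
      rw [eval_of_isHomogeneous_zero (((hF.pderiv (i := k)).pderiv (i := j)).pderiv), polarCoeff]
      ring
  have h4 : polar F ℂ x x (Pi.single k 1) =
      ∑ i, ∑ j, polarCoeff F i j k * (x i * x j) := by
    rw [polar_apply]
    refine Finset.sum_congr rfl fun i _ => Finset.sum_congr rfl fun j _ => ?_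
    simp [Pi.single_apply]
  have h5 : ∑ j, x j * eval x (pderiv j (pderiv k F)) = 6 * polar F ℂ x x (Pi.single k 1) := by
    rw [h4, Finset.sum_comm, Finset.mul_sum]
    refine Finset.sum_congr rfl fun j _ => ?_
    rw [← h2, Finset.mul_sum, Finset.mul_sum]
    refine Finset.sum_congr rfl fun i _ => ?_
    rw [h3]; ring
  rw [h5] at h1
  push_cast at h1
  linear_combination (-1 / 2) * h1

theorem eval_eq_polar {F : MvPolynomial ι ℂ} (hF : F.IsHomogeneous 3) (x : ι → ℂ) :
    eval x F = polar F ℂ x x x := by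
  classical
  have h1 := sum_mul_eval_pderiv hF x
  have h2 : polar F ℂ x x x = ∑ k, x k * polar F ℂ x x (Pi.single k 1) := by
    rw [LinearMap.pi_apply_eq_sum_univ (polar F ℂ x x) x]
    refine Finset.sum_congr rfl fun k _ => ?_
    rw [smul_eq_mul]
    congr 2
    ext j
    simp [Pi.single_apply, eq_comm]
  have h3 : ∑ k, x k * eval x (pderiv k F) = 3 * polar F ℂ x x x := by
    rw [h2, Finset.mul_sum]
    refine Finset.sum_congr rfl fun k _ => ?_
    rw [eval_pderiv_eq_polar hF]; ring
  rw [h3] at h1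
  push_cast at h1
  linear_combination (-1 / 3) * h1

end Polarization

/-! ### Planes through the line and their residual conics -/

section Trilinear

variable {V : Type*} [AddCommGroup V] [Module ℂ V]

/-- Symmetry of a trilinear form. -/
structure IsSymm₃ (T : V →ₗ[ℂ] V →ₗ[ℂ] V →ₗ[ℂ] ℂ) : Prop where
  swap₁₂ : ∀ x y z, T x y z = T y x z
  swap₂₃ : ∀ x y z, T x y z = T x z y

variable {T : V →ₗ[ℂ] V →ₗ[ℂ] V →ₗ[ℂ] ℂ}

theorem IsSymm₃.swap₁₃ (hT : IsSymm₃ T) (x y z : V) : T x y z = T z y x := by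
  rw [hT.swap₁₂, hT.swap₂₃, hT.swap₁₂]

theorem IsSymm₃.sq_add (hT : IsSymm₃ T) (a b : ℂ) (x y w : V) :
    T (a • x + b • y) (a • x + b • y) w =
      a ^ 2 * T x x w + 2 * a * b * T x y w + b ^ 2 * T y y w := by
  simp only [map_add, map_smul, LinearMap.add_apply, LinearMap.smul_apply, smul_eq_mul]
  rw [hT.swap₁₂ y x w]
  ring

theorem IsSymm₃.cube_add (hT : IsSymm₃ T) (a b : ℂ) (x y : V) :
    T (a • x + b • y) (a • x + b • y) (a • x + b • y) =
      a ^ 3 * T x x x + 3 * a ^ 2 * b * T x x y + 3 * a * b ^ 2 * T x y y + b ^ 3 * T y y y := by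
  rw [hT.sq_add]
  simp only [map_add, map_smul, smul_eq_mul]
  rw [hT.swap₁₃ y y x, hT.swap₂₃ x y x]
  ring

/-- `T` vanishes on the plane spanned by `p` and `q`. -/
structure VanishesOn (T : V →ₗ[ℂ] V →ₗ[ℂ] V →ₗ[ℂ] ℂ) (p q : V) : Prop where
  ppp : T p p p = 0
  ppq : T p p q = 0
  pqq : T p q q = 0
  qqq : T q q q = 0

/-- Every nonzero zero of the cubic form `T x x x` is a smooth point. -/
def IsSmooth₃ (T : V →ₗ[ℂ] V →ₗ[ℂ] V →ₗ[ℂ] ℂ) : Prop :=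
  ∀ x, x ≠ 0 → T x x x = 0 → ∃ e, T x x e ≠ 0

theorem VanishesOn.apply (hT : IsSymm₃ T) {p q : V} (h : VanishesOn T p q) (a b a₁ b₁ a₂ b₂ : ℂ) :
    T (a • p + b • q) (a₁ • p + b₁ • q) (a₂ • p + b₂ • q) = 0 := by
  simp only [map_add, map_smul, LinearMap.add_apply, LinearMap.smul_apply, smul_eq_mul,
    hT.swap₁₂ q p, hT.swap₁₃ q q p, hT.swap₂₃ p q p, h.ppp, h.ppq, h.pqq, h.qqq]
  ring

/-- The discriminant of the pencil of conics does not vanish identically. -/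
theorem exists_disc_ne_zero (hT : IsSymm₃ T) (hs : IsSmooth₃ T) {p q : V}
    (hpq : LinearIndependent ℂ ![p, q]) (h : VanishesOn T p q) :
    ∃ z, T p p z * T q q z - T p q z ^ 2 ≠ 0 := by
  by_contra! H
  have hne : ∀ a b : ℂ, a • p + b • q = 0 → a = 0 ∧ b = 0 := fun a b =>
    (LinearIndependent.pair_iff.1 hpq) a b
  have hp : p ≠ 0 := fun h0 => by simpa using hne 1 0 (by simp [h0])
  obtain ⟨e, he⟩ := hs p hp h.ppp
  set β := T p q e / T p p e with hβ
  have hb : ∀ z, T p q z = β * T p p z := fun z => by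
    -- This vector is killed by `T p p`, so the vanishing discriminant forces `T p q` to kill it
    -- too.
    have h1 := H (T p p e • z - T p p z • e)
    simp only [map_sub, map_smul, smul_eq_mul] at h1
    have h2 : T p p e * T p q z - T p p z * T p q e = 0 := by
      have : (T p p e * T p q z - T p p z * T p q e) ^ 2 = 0 := by
        linear_combination -h1
      exact pow_eq_zero_iff (two_ne_zero) |>.1 this
    rw [hβ]; field_simp; linear_combination h2
  have hc : ∀ z, T q q z = β ^ 2 * T p p z := fun z => by
    have key : ∀ w, T p p w ≠ 0 → T q q w = β ^ 2 * T p p w := fun w hw => by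
      have := H w
      rw [hb] at this
      exact mul_left_cancel₀ hw (by linear_combination this)
    by_cases hz : T p p z = 0
    -- Both `z + e` and `e` lie off the kernel of `T p p`, and the claim is additive.
    · have := key (z + e) (by simpa [hz] using he)
      simp only [map_add] at this
      linear_combination this - key e he
    · exact key z hz
  -- The derivative at `s • p + t • q` is proportional to `(s + β * t) ^ 2 * T p p`, so this point
  -- of the line is singular.
  obtain ⟨w, hw⟩ := hs ((-β) • p + (1 : ℂ) • q)
    (fun h0 => by simpa using (hne _ _ h0).2) (h.apply hT _ _ _ _ _ _)
  apply hw
  rw [hT.sq_add, hb, hc]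
  ring

/-- The determinant, up to a constant, of the conic residual to the line spanned by `p`, `q` in the
plane spanned by `p`, `q`, `z`. -/
def conicDet (T : V →ₗ[ℂ] V →ₗ[ℂ] V →ₗ[ℂ] ℂ) (p q z : V) : ℂ :=
  3 * (2 * T p q z * T p z z * T q z z - T q q z * T p z z ^ 2 - T p p z * T q z z ^ 2) +
    4 * (T p p z * T q q z - T p q z ^ 2) * T z z z

theorem hasDerivAt_cubic (a b c d : ℂ) :
    HasDerivAt (fun s : ℂ => a + s * b + s ^ 2 * c + s ^ 3 * d) b 0 := by
  have h1 : HasDerivAt (fun s : ℂ => s) 1 0 := hasDerivAt_id 0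
  have := (((hasDerivAt_const (0 : ℂ) a).add (h1.mul_const b)).add
    ((h1.pow 2).mul_const c)).add ((h1.pow 3).mul_const d)
  refine (this.congr_deriv (by simp)).congr_of_eventuallyEq (Filter.Eventually.of_forall fun s => ?_)
  simp

/-- Suppose the residual conic is singular in every plane where it meets the line in two points. The
pole of the line is then the vertex of the conic. The determinant vanishes on an open set of `z`, so
its derivative in every direction vanishes too; at a degenerate conic, that derivative evaluates the
variation of the conic at the vertex. Hence the vertex is a singular point of the cubic. -/
theorem exists_conicDet_ne_zero (hT : IsSymm₃ T) (hs : IsSmooth₃ T) {p q : V}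
    (hpq : LinearIndependent ℂ ![p, q]) (h : VanishesOn T p q) :
    ∃ z, T p p z * T q q z - T p q z ^ 2 ≠ 0 ∧ conicDet T p q z ≠ 0 := by
  by_contra! H
  obtain ⟨z, hz⟩ := exists_disc_ne_zero hT hs hpq h
  set h0 := 2 * (T p p z * T q q z - T p q z ^ 2) with hh0
  have hh0' : h0 ≠ 0 := mul_ne_zero two_ne_zero hz
  -- `(s0, t0, h0)` is the pole of the line `p q` with respect to the residual conic, by Cramer's
  -- rule.
  set s0 := T p q z * T q z z - T q q z * T p z z with hs0
  set t0 := T p q z * T p z z - T p p z * T q z z with ht0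
  have hδ := H z hz
  have key : ∀ e, T (s0 • p + t0 • q + h0 • z) (s0 • p + t0 • q + h0 • z) e = 0 := fun e => by
    have lin : ∀ x y : V, HasDerivAt (fun s : ℂ => T x y (z + s • e)) (T x y e) 0 := fun x y => by
      refine (hasDerivAt_cubic (T x y z) (T x y e) 0 0).congr_of_eventuallyEq
        (Filter.Eventually.of_forall fun s => ?_)
      simp
    have quad : ∀ x : V, HasDerivAt (fun s : ℂ => T x (z + s • e) (z + s • e)) (2 * T x z e) 0 :=
      fun x => by
        refine (hasDerivAt_cubic (T x z z) (2 * T x z e) (T x e e) 0).congr_of_eventuallyEq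
          (Filter.Eventually.of_forall fun s => ?_)
        simp [hT.swap₂₃ x e z]
        ring
    have cub : HasDerivAt (fun s : ℂ => T (z + s • e) (z + s • e) (z + s • e)) (3 * T z z e) 0 := by
      refine (hasDerivAt_cubic (T z z z) (3 * T z z e) (3 * T z e e) (T e e e)).congr_of_eventuallyEq
        (Filter.Eventually.of_forall fun s => ?_)
      have := hT.cube_add 1 s z e
      rw [one_smul] at this
      dsimp only
      rw [this]; ring
    have hdisc : HasDerivAt (fun s : ℂ => T p p (z + s • e) * T q q (z + s • e) -
        T p q (z + s • e) ^ 2) _ 0 := ((lin p p).mul (lin q q)).sub ((lin p q).pow 2)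
    have hdet : HasDerivAt (fun s : ℂ => conicDet T p q (z + s • e)) _ 0 :=
      ((((((lin p q).const_mul 2).mul (quad p)).mul (quad q)).sub
        ((lin q q).mul ((quad p).pow 2))).sub ((lin p p).mul ((quad q).pow 2))).const_mul 3 |>.add
        ((hdisc.const_mul 4).mul cub)
    have hev : (fun s : ℂ => conicDet T p q (z + s • e)) =ᶠ[nhds 0] fun _ => 0 := by
      have : ∀ᶠ s in nhds (0 : ℂ), T p p (z + s • e) * T q q (z + s • e) -
          T p q (z + s • e) ^ 2 ≠ 0 := by
        refine hdisc.continuousAt.eventually_ne ?_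
        simpa using hz
      filter_upwards [this] with s hs using H _ hs
    have h1 := (hdet.congr_of_eventuallyEq hev.symm).unique (hasDerivAt_const (0 : ℂ) (0 : ℂ))
    simp only [zero_smul, add_zero, Pi.mul_apply, Pi.pow_apply] at h1
    have h2 : T (s0 • p + t0 • q + h0 • z) (s0 • p + t0 • q + h0 • z) e =
        s0 ^ 2 * T p p e + 2 * s0 * t0 * T p q e + t0 ^ 2 * T q q e +
          2 * h0 * (s0 * T p z e + t0 * T q z e) + h0 ^ 2 * T z z e := by
      have := hT.sq_add 1 h0 (s0 • p + t0 • q) z e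
      rw [one_smul, hT.sq_add] at this
      rw [this]
      simp only [map_add, map_smul, LinearMap.add_apply, LinearMap.smul_apply, smul_eq_mul]
      ring
    rw [conicDet] at hδ
    rw [h2, hs0, ht0, hh0]
    -- With Δ the discriminant, δ the determinant and primes for derivatives along `e`, the left
    -- side is `(Δ δ' - Δ' δ) / 3`.
    linear_combination ((T p p z * T q q z - T p q z ^ 2) / 3) * h1 -
      ((T p p e * T q q z + T p p z * T q q e - 2 * T p q z * T p q e) / 3) * hδ
  -- Otherwise `z` would lie in the plane of `p` and `q`, where `T p p` and `T p q` vanish.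
  have hx0 : s0 • p + t0 • q + h0 • z ≠ 0 := fun h1 => hz <| by
    have h2 : ∀ x y, h0 * T x y z = -(s0 * T x y p + t0 * T x y q) := fun x y => by
      have := congrArg (T x y) h1
      simp only [map_add, map_smul, smul_eq_mul, map_zero] at this
      linear_combination this
    have h3 := h2 p p
    have h4 := h2 p q
    rw [h.ppp, h.ppq] at h3
    rw [hT.swap₂₃ p q p, h.ppq, h.pqq] at h4
    have h5 : T p p z = 0 := (mul_eq_zero.1 (by simpa using h3)).resolve_left hh0'
    have h6 : T p q z = 0 := (mul_eq_zero.1 (by simpa using h4)).resolve_left hh0'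
    rw [h5, h6]; ring
  obtain ⟨e, he⟩ := hs _ hx0 (key _)
  exact he (key e)

theorem exists_isotropic_pair {a b c : ℂ} (h : a * c - b ^ 2 ≠ 0) :
    ∃ α β γ δ : ℂ, α * δ - β * γ ≠ 0 ∧ a * α ^ 2 + 2 * b * α * β + c * β ^ 2 = 0 ∧
      a * γ ^ 2 + 2 * b * γ * δ + c * δ ^ 2 = 0 := by
  by_cases ha : a = 0
  · subst ha
    have hb : b ≠ 0 := fun hb => h (by simp [hb])
    exact ⟨1, 0, c, -2 * b, by simpa using hb, by ring, by ring⟩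
  · obtain ⟨r, hr⟩ := IsAlgClosed.exists_pow_nat_eq (b ^ 2 - a * c) (n := 2) two_pos
    have hr0 : r ≠ 0 := fun hr0 => h (by rw [hr0] at hr; linear_combination hr)
    refine ⟨-b + r, a, -b - r, a, ?_, by linear_combination a * hr, by linear_combination a * hr⟩
    have : (-b + r) * a - a * (-b - r) = 2 * a * r := by ring
    rw [this]
    exact mul_ne_zero (mul_ne_zero two_ne_zero ha) hr0

/-- For a suitable plane through the line the residual conic is smooth and meets the line in two
distinct points. -/
theorem exists_transversal_plane (hT : IsSymm₃ T) (hs : IsSmooth₃ T) {b₀ b₁ : V}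
    (hb : LinearIndependent ℂ ![b₀, b₁]) (h : VanishesOn T b₀ b₁) :
    ∃ p q z : V, LinearIndependent ℂ ![p, q] ∧ VanishesOn T p q ∧ T p p z = 0 ∧ T q q z = 0 ∧
      T p q z ≠ 0 ∧ 2 * T p q z * T z z z ≠ 3 * T p z z * T q z z := by
  obtain ⟨z, hz, hδ⟩ := exists_conicDet_ne_zero hT hs hb h
  obtain ⟨α, β, γ, δ, hdet, h1, h2⟩ := exists_isotropic_pair hz
  set p := α • b₀ + β • b₁ with hp
  set q := γ • b₀ + δ • b₁ with hq
  have hpq : VanishesOn T p q := ⟨h.apply hT _ _ _ _ _ _, h.apply hT _ _ _ _ _ _,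
    h.apply hT _ _ _ _ _ _, h.apply hT _ _ _ _ _ _⟩
  have hp1 : T p p z = 0 := by rw [hp, hT.sq_add]; linear_combination h1
  have hq1 : T q q z = 0 := by rw [hq, hT.sq_add]; linear_combination h2
  have hτ : T p q z = α * γ * T b₀ b₀ z + (α * δ + β * γ) * T b₀ b₁ z + β * δ * T b₁ b₁ z := by
    rw [hp, hq]
    simp only [map_add, map_smul, LinearMap.add_apply, LinearMap.smul_apply, smul_eq_mul,
      hT.swap₁₂ b₁ b₀ z]
    ring
  have hpz : T p z z = α * T b₀ z z + β * T b₁ z z := by rw [hp]; simp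
  have hqz : T q z z = γ * T b₀ z z + δ * T b₁ z z := by rw [hq]; simp
  have hdisc : T p q z ^ 2 = (α * δ - β * γ) ^ 2 * (T b₀ b₁ z ^ 2 - T b₀ b₀ z * T b₁ b₁ z) := by
    rw [hτ]
    linear_combination (T b₀ b₀ z * γ ^ 2 + 2 * T b₀ b₁ z * γ * δ + T b₁ b₁ z * δ ^ 2) * h1
  have hτ0 : T p q z ≠ 0 := fun h0 => by
    rw [h0] at hdisc
    have := mul_ne_zero (pow_ne_zero 2 hdet) hz
    apply this
    linear_combination hdisc
  refine ⟨p, q, z, ?_, hpq, hp1, hq1, hτ0, fun H => ?_⟩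
  · rw [LinearIndependent.pair_iff]
    intro s t hst
    have e1 := congrArg (fun v => T p v z) hst
    have e2 := congrArg (fun v => T q v z) hst
    simp only [map_add, map_smul, LinearMap.add_apply, LinearMap.smul_apply, smul_eq_mul, hp1, hq1,
      map_zero, LinearMap.zero_apply, hT.swap₁₂ q p z, mul_zero, zero_add, add_zero] at e1 e2
    exact ⟨(mul_eq_zero.1 e2).resolve_right hτ0, (mul_eq_zero.1 e1).resolve_right hτ0⟩
  -- The determinant of a quadratic form scales by the square of the determinant of the change of
  -- basis.
  · have hdetpq : (α * δ - β * γ) ^ 2 * conicDet T b₀ b₁ z = conicDet T p q z := by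
      have e1 : T p p z = α ^ 2 * T b₀ b₀ z + 2 * α * β * T b₀ b₁ z + β ^ 2 * T b₁ b₁ z := by
        rw [hp, hT.sq_add]
      have e2 : T q q z = γ ^ 2 * T b₀ b₀ z + 2 * γ * δ * T b₀ b₁ z + δ ^ 2 * T b₁ b₁ z := by
        rw [hq, hT.sq_add]
      rw [conicDet, conicDet, e1, e2, hτ, hpz, hqz]
      ring
    refine mul_ne_zero (pow_ne_zero 2 hdet) hδ ?_
    rw [hdetpq, conicDet, hp1, hq1]
    linear_combination (-2 * T p q z) * H

/-- If the conic residual to the line `p q` in the plane `p q z` is smooth, it has points off the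
tangent hyperplanes at `p` and `q` whose coordinates avoid prescribed values. -/
theorem exists_point_on_conic (hT : IsSymm₃ T) {p q z : V} (hpq : VanishesOn T p q)
    (hp : T p p z = 0) (hq : T q q z = 0) (hτ : T p q z ≠ 0)
    (hdet : 2 * T p q z * T z z z ≠ 3 * T p z z * T q z z) (α₀ β₀ : ℂ) :
    ∃ α β : ℂ, α ≠ α₀ ∧ β ≠ β₀ ∧
      T (α • p + β • q + z) (α • p + β • q + z) (α • p + β • q + z) = 0 ∧
      T p (α • p + β • q + z) (α • p + β • q + z) ≠ 0 ∧
      T q (α • p + β • q + z) (α • p + β • q + z) ≠ 0 := by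
  set τ := T p q z with hτdef
  -- With `A = 2τα + T q z z` and `B = 2τβ + T p z z` the conic is the hyperbola `A * B = κ`.
  -- Moreover `T q x x = A` and `T p x x = B` for `x = α • p + β • q + z`, so any `B` outside three
  -- values will do.
  set κ := T p z z * T q z z - 2 / 3 * τ * T z z z with hκ
  have hκ0 : κ ≠ 0 := fun h0 => hdet (by rw [hκ] at h0; linear_combination -3 * h0)
  obtain ⟨B, hB⟩ := Infinite.exists_notMem_finset
    ({0, 2 * τ * β₀ + T p z z, κ / (2 * τ * α₀ + T q z z)} : Finset ℂ)
  simp only [Finset.mem_insert, Finset.mem_singleton, not_or] at hB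
  obtain ⟨hB0, hB1, hB2⟩ := hB
  refine ⟨(κ / B - T q z z) / (2 * τ), (B - T p z z) / (2 * τ), ?_, ?_, ?_, ?_, ?_⟩
  · intro h
    apply hB2
    have h1 : κ / B = 2 * τ * α₀ + T q z z := by
      rw [← h]; field_simp; ring
    rw [← h1]; field_simp
  · intro h
    apply hB1
    rw [← h]; field_simp; ring
  all_goals
    generalize hα : (κ / B - T q z z) / (2 * τ) = α
    generalize hβ : (B - T p z z) / (2 * τ) = β
    have eB : 2 * τ * β + T p z z = B := by rw [← hβ]; field_simp; ring
    have eA : (2 * τ * α + T q z z) * B = κ := by rw [← hα]; field_simp; ring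
  · have e := hT.cube_add 1 1 (α • p + β • q) z
    rw [one_smul, one_smul, hT.cube_add, hT.sq_add, hpq.ppp, hpq.ppq, hpq.pqq, hpq.qqq, hp, hq] at e
    rw [e]
    simp only [map_add, map_smul, LinearMap.add_apply, LinearMap.smul_apply, smul_eq_mul]
    rw [← hτdef]
    rw [← eB, hκ] at eA
    refine mul_left_cancel₀ hτ ?_
    linear_combination (3 / 2) * eA
  · have : T p (α • p + β • q + z) (α • p + β • q + z) = B := by
      simp only [map_add, map_smul, LinearMap.add_apply, LinearMap.smul_apply, smul_eq_mul,
        hpq.ppp, hpq.ppq, hpq.pqq, hT.swap₂₃ p q p, hT.swap₂₃ p z p, hT.swap₂₃ p z q, hp,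
        ← hτdef, ← eB]
      ring
    rwa [this]
  · have : T q (α • p + β • q + z) (α • p + β • q + z) = 2 * τ * α + T q z z := by
      simp only [map_add, map_smul, LinearMap.add_apply, LinearMap.smul_apply, smul_eq_mul,
        hT.swap₁₂ q p, hT.swap₂₃ q z p, hT.swap₂₃ q z q, hT.swap₂₃ p q p, hT.swap₁₃ q q p,
        hpq.ppq, hpq.pqq, hpq.qqq, hq, ← hτdef]
      ring
    rw [this]
    exact fun h0 => hκ0 (by rw [← eA, h0, zero_mul])

theorem exists_apply_ne_zero_pair {f g : V →ₗ[ℂ] ℂ} (hf : ∃ e, f e ≠ 0) (hg : ∃ e, g e ≠ 0) :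
    ∃ e, f e ≠ 0 ∧ g e ≠ 0 := by
  obtain ⟨x, hx⟩ := hf
  obtain ⟨y, hy⟩ := hg
  by_cases h1 : g x = 0
  · by_cases h2 : f y = 0
    · exact ⟨x + y, by simpa [h2] using hx, by simpa [h1] using hy⟩
    · exact ⟨y, h2, hy⟩
  · exact ⟨x, hx, h1⟩

end Trilinear

/-! ### Irreducibility of a smooth cubic form -/

section Irreducible

variable {ι : Type} [Fintype ι]

theorem exists_linearMap_eq_eval {G : MvPolynomial ι ℂ} (hG : G.IsHomogeneous 1) :
    ∃ l : (ι → ℂ) →ₗ[ℂ] ℂ, ∀ x, eval x G = l x := by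
  refine ⟨∑ i, eval 0 (pderiv i G) • LinearMap.proj i, fun x => ?_⟩
  have h := sum_mul_eval_pderiv hG x
  simp only [Nat.cast_one, one_mul] at h
  rw [← h]
  simp only [LinearMap.sum_apply, LinearMap.smul_apply, LinearMap.proj_apply, smul_eq_mul]
  refine Finset.sum_congr rfl fun i _ => ?_
  rw [eval_of_isHomogeneous_zero (hG.pderiv (i := i)), mul_comm]

theorem exists_bilin_eq_eval {G : MvPolynomial ι ℂ} (hG : G.IsHomogeneous 2) :
    ∃ b : (ι → ℂ) →ₗ[ℂ] (ι → ℂ) →ₗ[ℂ] ℂ, ∀ x, eval x G = b x x := by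
  choose l hl using fun i => exists_linearMap_eq_eval (hG.pderiv (i := i))
  refine ⟨(1 / 2 : ℂ) • ∑ i, (LinearMap.proj i).smulRight (l i), fun x => ?_⟩
  have h := sum_mul_eval_pderiv hG x
  simp only [hl] at h
  simp only [LinearMap.smul_apply, LinearMap.sum_apply, LinearMap.smulRight_apply,
    LinearMap.proj_apply, smul_eq_mul, h]
  push_cast
  ring

/-- The kernel of the linear form contains two independent vectors, and a quadratic form on their
span has a nontrivial zero. -/
theorem exists_common_zero (hι : 3 ≤ Fintype.card ι) {G H : MvPolynomial ι ℂ}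
    (hG : G.IsHomogeneous 1) (hH : H.IsHomogeneous 2) :
    ∃ x : ι → ℂ, x ≠ 0 ∧ eval x G = 0 ∧ eval x H = 0 := by
  obtain ⟨l, hl⟩ := exists_linearMap_eq_eval hG
  obtain ⟨b, hb⟩ := exists_bilin_eq_eval hH
  have hdim : 1 < Module.finrank ℂ (LinearMap.ker l) := by
    have h1 := LinearMap.finrank_range_add_finrank_ker l
    have h2 : Module.finrank ℂ (LinearMap.range l) ≤ 1 := by
      simpa using Submodule.finrank_le (LinearMap.range l)
    rw [Module.finrank_fintype_fun_eq_card] at h1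
    omega
  have : Nontrivial (LinearMap.ker l) := 
    Module.nontrivial_of_finrank_pos (zero_lt_one.trans hdim)
  obtain ⟨v, hv⟩ := exists_ne (0 : LinearMap.ker l)
  obtain ⟨w, hvw⟩ := exists_linearIndependent_pair_of_one_lt_finrank hdim hv
  rw [LinearIndependent.pair_iff] at hvw
  by_cases h0 : b v v = 0
  · exact ⟨v, by simpa using hv, by rw [hl]; exact v.2, by rw [hb, h0]⟩
  obtain ⟨s, hs⟩ := IsAlgClosed.exists_pow_nat_eq
    (discrim (b v v) (b v w + b w v) (b w w)) (n := 2) two_pos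
  obtain ⟨r, hr⟩ := exists_quadratic_eq_zero h0 ⟨s, by rw [← hs]; ring⟩
  refine ⟨((r • v + (1 : ℂ) • w : LinearMap.ker l) : ι → ℂ), fun h => ?_, ?_, ?_⟩
  · exact one_ne_zero (hvw _ _ (Subtype.ext h)).2
  · rw [hl]; exact (r • v + (1 : ℂ) • w).2
  · rw [hb]
    simp only [one_smul, Submodule.coe_add, Submodule.coe_smul, map_add, map_smul,
      LinearMap.add_apply, LinearMap.smul_apply, smul_eq_mul]
    linear_combination hr

/-- A factorization of a form can be replaced by one into forms. -/
theorem homogeneousComponent_mul_top {ι : Type} {F G H : MvPolynomial ι ℂ} {d : ℕ} (hF : F.IsHomogeneous d)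
    (hF0 : F ≠ 0) (h : F = G * H) :
    G.totalDegree + H.totalDegree = d ∧
      F = homogeneousComponent G.totalDegree G * homogeneousComponent H.totalDegree H := by
  have hG0 : G ≠ 0 := fun h0 => hF0 (by rw [h, h0, zero_mul])
  have hH0 : H ≠ 0 := fun h0 => hF0 (by rw [h, h0, mul_zero])
  have hd : G.totalDegree + H.totalDegree = d := by
    rw [← totalDegree_mul_of_isDomain hG0 hH0, ← h, hF.totalDegree hF0]
  refine ⟨hd, ?_⟩
  have h1 : F = ∑ i ∈ Finset.range (G.totalDegree + 1), ∑ j ∈ Finset.range (H.totalDegree + 1),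
      homogeneousComponent d (homogeneousComponent i G * homogeneousComponent j H) := by
    conv_lhs => rw [← homogeneousComponent_eq_self hF, h, ← sum_homogeneousComponent G,
      ← sum_homogeneousComponent H, Finset.sum_mul_sum]
    simp only [map_sum]
  have hmem : ∀ i j, homogeneousComponent i G * homogeneousComponent j H ∈
      homogeneousSubmodule ι ℂ (i + j) := fun i j =>
    (homogeneousComponent_isHomogeneous i G).mul (homogeneousComponent_isHomogeneous j H)
  -- Only the product of the two top components reaches degree `d`.
  rw [h1, Finset.sum_eq_single G.totalDegree, Finset.sum_eq_single H.totalDegree]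
  · rw [homogeneousComponent_of_mem (hmem _ _), if_pos hd.symm]
  · intro j hj hne
    rw [Finset.mem_range] at hj
    rw [homogeneousComponent_of_mem (hmem _ _), if_neg (by omega)]
  · intro hj; simp at hj
  · intro i hi hne
    refine Finset.sum_eq_zero fun j hj => ?_
    rw [Finset.mem_range] at hi hj
    rw [homogeneousComponent_of_mem (hmem _ _), if_neg (by omega)]
  · intro hj; simp at hj

theorem isUnit_of_totalDegree_eq_zero {ι : Type} {G : MvPolynomial ι ℂ} (h0 : G ≠ 0)
    (h : G.totalDegree = 0) : IsUnit G := by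
  rw [totalDegree_eq_zero_iff_eq_C] at h
  rw [h]
  refine IsUnit.map C (isUnit_iff_ne_zero.2 fun hc => h0 ?_)
  rw [h, hc, map_zero]

/-- A reducible cubic form has a linear and a quadratic factor; by the product rule, a common zero
of the two is a singular point. -/
theorem irreducible_of_smooth (hι : 3 ≤ Fintype.card ι) {F : MvPolynomial ι ℂ}
    (hF : F.IsHomogeneous 3) (hF0 : F ≠ 0)
    (hs : ∀ x : ι → ℂ, x ≠ 0 → eval x F = 0 → ∃ i, eval x (pderiv i F) ≠ 0) : Irreducible F := by
  have key : ∀ G H : MvPolynomial ι ℂ, G.IsHomogeneous 1 → H.IsHomogeneous 2 → F ≠ G * H := by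
    intro G H hG hH h
    obtain ⟨x, hx, h1, h2⟩ := exists_common_zero hι hG hH
    obtain ⟨i, hi⟩ := hs x hx (by rw [h, map_mul, h1, zero_mul])
    apply hi
    rw [h, pderiv_mul, map_add, map_mul, map_mul, h1, h2]
    ring
  refine ⟨fun hu => ?_, fun G H h => ?_⟩
  · rw [isUnit_iff_totalDegree_of_isReduced, hF.totalDegree hF0] at hu
    omega
  · have hG0 : G ≠ 0 := fun h0 => hF0 (by rw [h, h0, zero_mul])
    have hH0 : H ≠ 0 := fun h0 => hF0 (by rw [h, h0, mul_zero])
    obtain ⟨hd, h'⟩ := homogeneousComponent_mul_top hF hF0 h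
    have hG := homogeneousComponent_isHomogeneous G.totalDegree G
    have hH := homogeneousComponent_isHomogeneous H.totalDegree H
    have : G.totalDegree = 0 ∨ H.totalDegree = 0 ∨
        (G.totalDegree = 1 ∧ H.totalDegree = 2) ∨ (G.totalDegree = 2 ∧ H.totalDegree = 1) := by
      omega
    rcases this with h1 | h1 | ⟨h1, h2⟩ | ⟨h1, h2⟩
    · exact Or.inl (isUnit_of_totalDegree_eq_zero hG0 h1)
    · exact Or.inr (isUnit_of_totalDegree_eq_zero hH0 h1)
    · exact absurd h' (key _ _ (h1 ▸ hG) (h2 ▸ hH))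
    · rw [mul_comm] at h'
      exact absurd h' (key _ _ (h2 ▸ hH) (h1 ▸ hG))

end Irreducible

/-! ### Relations between the parametrizing forms, by transcendence degree -/

section TranscendenceDegree

/-- A surjection of domains that does not lower the (finite) transcendence degree is injective. -/
theorem injective_of_surjective_of_trdeg_le {k A A' : Type} [Field k] [CommRing A] [IsDomain A]
    [Algebra k A] [CommRing A'] [IsDomain A'] [Algebra k A'] (f : A →ₐ[k] A')
    (hf : Function.Surjective f) (hfin : Algebra.trdeg k A < Cardinal.aleph0)
    (hle : Algebra.trdeg k A ≤ Algebra.trdeg k A') : Function.Injective f := by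
  obtain ⟨s, hs⟩ := exists_isTranscendenceBasis k A'
  choose g hg using hf
  set x : s → A := fun i => g i with hx
  have hfx : f ∘ x = ((↑) : s → A') := funext fun i => hg i
  have hind : AlgebraicIndependent k x := by
    have h1 := hs.1
    rw [← hfx] at h1
    exact h1.of_comp f
  have hbas : IsTranscendenceBasis k x :=
    hind.isTranscendenceBasis_of_trdeg_le hfin (hle.trans hs.cardinalMk_eq_trdeg.ge)
  have halg := hbas.isAlgebraic
  rw [injective_iff_map_eq_zero]
  intro a ha
  by_contra ha0
  -- A nonzero kernel element divides a nonzero polynomial in the lifted basis; applying `f` gives a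
  -- relation in the basis of `A'`.
  obtain ⟨r, hr0, hr⟩ := (halg.isAlgebraic a).exists_nonzero_dvd (mem_nonZeroDivisors_of_ne_zero ha0)
  obtain ⟨r, hrm⟩ := r
  rw [Algebra.adjoin_range_eq_range_aeval] at hrm
  obtain ⟨P, rfl⟩ := hrm
  obtain ⟨c, hc⟩ := hr
  have h2 : aeval ((↑) : s → A') P = 0 := by
    have h3 : (aeval x P : A) = a * c := hc
    have h4 : f (aeval x P) = aeval (f ∘ x) P := comp_aeval_apply x f P
    rw [← hfx, ← h4, h3, map_mul, ha, zero_mul]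
  have hP : P = 0 := (injective_iff_map_eq_zero _).1 hs.1 _ h2
  apply hr0
  ext
  simp [hP]

/-- Otherwise the `m + 1` generators would be algebraically independent, against the relation `F`.
-/
theorem trdeg_quotient_le {m : ℕ} {F : MvPolynomial (Fin (m + 1)) ℂ} (hF : Prime F) :
    Algebra.trdeg ℂ (MvPolynomial (Fin (m + 1)) ℂ ⧸ Ideal.span {F}) ≤ m := by
  have : (Ideal.span {F}).IsPrime := (Ideal.span_singleton_prime hF.ne_zero).2 hF
  set A := MvPolynomial (Fin (m + 1)) ℂ ⧸ Ideal.span {F}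
  by_contra! H
  set x : Fin (m + 1) → A := fun i => Ideal.Quotient.mkₐ ℂ _ (X i) with hx
  have hmk : Ideal.Quotient.mkₐ ℂ (Ideal.span {F}) = aeval x := by ext i; simp [hx]
  have htop : Algebra.adjoin ℂ (Set.range x) = ⊤ := by
    rw [Algebra.adjoin_range_eq_range_aeval, ← hmk, AlgHom.range_eq_top]
    exact Ideal.Quotient.mkₐ_surjective _ _
  have : Algebra.IsAlgebraic (Algebra.adjoin ℂ (Set.range x)) A := by
    constructor
    intro a
    have ha : a ∈ Algebra.adjoin ℂ (Set.range x) := htop ▸ Algebra.mem_top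
    exact isAlgebraic_algebraMap (⟨a, ha⟩ : Algebra.adjoin ℂ (Set.range x))
  have hle : Cardinal.mk (Fin (m + 1)) ≤ Algebra.trdeg ℂ A := by
    rw [Cardinal.mk_fin, Nat.cast_add_one, ← Cardinal.succ_natCast]
    exact Order.succ_le_of_lt H
  have hb := Algebra.IsAlgebraic.isTranscendenceBasis_of_le_trdeg_of_finite ℂ x hle
  refine hF.ne_zero ((injective_iff_map_eq_zero (aeval (R := ℂ) x)).1 hb.1 F ?_)
  rw [← hmk]
  exact Ideal.Quotient.eq_zero_iff_mem.2 (Ideal.mem_span_singleton_self F)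

/-- Forms `f i` in `m` variables over which the rational function field is algebraic satisfy, up to
multiples, only one relation. -/
theorem dvd_of_aeval_eq_zero {m : ℕ} {F : MvPolynomial (Fin (m + 1)) ℂ} (hF : Prime F)
    (f : Fin (m + 1) → MvPolynomial (Fin m) ℂ) (hFf : aeval f F = 0)
    (halg : ∀ i, IsAlgebraic (aeval (R := ℂ) f).range (X i : MvPolynomial (Fin m) ℂ))
    (G : MvPolynomial (Fin (m + 1)) ℂ) (hG : aeval f G = 0) : F ∣ G := by
  have : (Ideal.span {F}).IsPrime := (Ideal.span_singleton_prime hF.ne_zero).2 hF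
  set A' := (aeval (R := ℂ) f).range
  have hA : Algebra.IsAlgebraic A' (MvPolynomial (Fin m) ℂ) :=
    (IsTranscendenceBasis.mvPolynomial (Fin m) ℂ).isAlgebraic_iff.2 halg
  have htr : Algebra.trdeg ℂ A' = m := by
    have : FaithfulSMul ℂ A' := (faithfulSMul_iff_algebraMap_injective ℂ A').2
      (algebraMap ℂ A').injective
    have h1 := trdeg_add_eq ℂ A' (A := MvPolynomial (Fin m) ℂ)
    rw [trdeg_eq_zero (R := A'), add_zero, MvPolynomial.trdeg_of_isDomain] at h1
    simpa using h1
  set φ : (MvPolynomial (Fin (m + 1)) ℂ ⧸ Ideal.span {F}) →ₐ[ℂ] A' :=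
    Ideal.Quotient.liftₐ (Ideal.span {F}) (aeval (R := ℂ) f).rangeRestrict (by
      intro a ha
      obtain ⟨c, rfl⟩ := Ideal.mem_span_singleton.1 ha
      refine Subtype.ext ?_
      change aeval f (F * c) = 0
      rw [map_mul, hFf, zero_mul]) with hφ
  have hle := trdeg_quotient_le hF
  have hinj : Function.Injective φ := by
    refine injective_of_surjective_of_trdeg_le φ ?_ (hle.trans_lt (Cardinal.natCast_lt_aleph0))
      (hle.trans htr.ge)
    exact Ideal.Quotient.lift_surjective_of_surjective _ _ (AlgHom.rangeRestrict_surjective _)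
  rw [← Ideal.mem_span_singleton, ← Ideal.Quotient.eq_zero_iff_mem]
  refine (injective_iff_map_eq_zero φ).1 hinj _ ?_
  exact Subtype.ext hG

end TranscendenceDegree

/-! ### Linear functionals as polynomials -/

section LinearForms

variable {ι : Type} [Fintype ι] [DecidableEq ι]

/-- The linear form, as a polynomial, of a linear functional. -/
def linearForm (l : (ι → ℂ) →ₗ[ℂ] ℂ) : MvPolynomial ι ℂ :=
  ∑ j, C (l (Pi.single j 1)) * X j

theorem isHomogeneous_linearForm (l : (ι → ℂ) →ₗ[ℂ] ℂ) : (linearForm l).IsHomogeneous 1 :=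
  IsHomogeneous.sum _ _ _ fun j _ => isHomogeneous_C_mul_X _ j

theorem eval_linearForm (l : (ι → ℂ) →ₗ[ℂ] ℂ) (x : ι → ℂ) : eval x (linearForm l) = l x := by
  rw [linearForm, LinearMap.pi_apply_eq_sum_univ l x, map_sum]
  refine Finset.sum_congr rfl fun k _ => ?_
  rw [map_mul, eval_C, eval_X, smul_eq_mul, mul_comm]
  congr 2
  ext j
  simp [Pi.single_apply, eq_comm]

end LinearForms

theorem eval_aeval {σ τ : Type} (f : τ → MvPolynomial σ ℂ) (G : MvPolynomial τ ℂ) (y : σ → ℂ) :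
    eval y (aeval f G) = eval (fun i => eval y (f i)) G := by
  have h := comp_aeval_apply f (aeval (R := ℂ) y) G
  simpa [aeval_eq_eval] using h

theorem eval_polar {ι σ : Type} [Fintype ι] (F : MvPolynomial ι ℂ) (x y z : ι → MvPolynomial σ ℂ)
    (w : σ → ℂ) : eval w (polar F (MvPolynomial σ ℂ) x y z) =
      polar F ℂ (fun i => eval w (x i)) (fun i => eval w (y i)) (fun i => eval w (z i)) := by
  have h := map_polar F (aeval (R := ℂ) w) x y z
  simpa [aeval_eq_eval] using h

/-! ### The residual point of a tangent line and its fibres -/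

section Construction

variable {n : ℕ} (F : MvPolynomial (Fin (n + 1)) ℂ)
  (B : Module.Basis (Option (Fin n)) ℂ (Fin (n + 1) → ℂ)) (i₀ i₁ : Fin n)

variable (R : Type) [CommRing R] [Algebra ℂ R]

/-- A complex vector, as a vector over a `ℂ`-algebra. -/
def constVec (v : Fin (n + 1) → ℂ) : Fin (n + 1) → R := fun j => algebraMap ℂ R (v j)

variable {R}

/-- The point of the line with coordinates `y i₀`, `y i₁`. -/
def linePt (y : Fin n → R) : Fin (n + 1) → R :=
  y i₀ • constVec R (B (some i₀)) + y i₁ • constVec R (B (some i₁))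

/-- An arbitrary direction at `linePt`. -/
def dirPt (y : Fin n → R) : Fin (n + 1) → R :=
  ∑ i, (if i = i₀ then 0 else y i) • constVec R (B (some i))

/-- The direction `dirPt`, projected from `B none` to the tangent space of the cubic at `linePt`. -/
def tangentDir (y : Fin n → R) : Fin (n + 1) → R :=
  polar F R (linePt B i₀ i₁ y) (linePt B i₀ i₁ y) (constVec R (B none)) • dirPt B i₀ y -
    polar F R (linePt B i₀ i₁ y) (linePt B i₀ i₁ y) (dirPt B i₀ y) • constVec R (B none)

/-- The residual intersection point of the cubic with the tangent line. -/
def residualPt (y : Fin n → R) : Fin (n + 1) → R :=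
  (3 * polar F R (linePt B i₀ i₁ y) (tangentDir F B i₀ i₁ y) (tangentDir F B i₀ i₁ y)) •
      tangentDir F B i₀ i₁ y -
    polar F R (tangentDir F B i₀ i₁ y) (tangentDir F B i₀ i₁ y) (tangentDir F B i₀ i₁ y) •
      linePt B i₀ i₁ y

theorem constVec_complex (v : Fin (n + 1) → ℂ) : constVec ℂ v = v := rfl

theorem eval_constVec (v : Fin (n + 1) → ℂ) (y : Fin n → ℂ) :
    (fun j => eval y (constVec (MvPolynomial (Fin n) ℂ) v j)) = v := by
  ext j; simp [constVec, MvPolynomial.algebraMap_eq]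

theorem eval_linePt (y : Fin n → ℂ) : (fun j => eval y (linePt B i₀ i₁
    (X : Fin n → MvPolynomial (Fin n) ℂ) j)) = linePt B i₀ i₁ y := by
  ext j; simp [linePt, constVec, MvPolynomial.algebraMap_eq]

theorem eval_dirPt (y : Fin n → ℂ) : (fun j => eval y (dirPt B i₀
    (X : Fin n → MvPolynomial (Fin n) ℂ) j)) = dirPt B i₀ y := by
  ext j
  simp only [dirPt, constVec, MvPolynomial.algebraMap_eq, Finset.sum_apply, Pi.smul_apply,
    smul_eq_mul, map_sum, map_mul, eval_C, Algebra.algebraMap_self, RingHom.id_apply]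
  refine Finset.sum_congr rfl fun i _ => ?_
  split_ifs <;> simp

theorem eval_tangentDir (y : Fin n → ℂ) : (fun j => eval y (tangentDir F B i₀ i₁
    (X : Fin n → MvPolynomial (Fin n) ℂ) j)) = tangentDir F B i₀ i₁ y := by
  ext j
  have h1 := congrFun (eval_dirPt B i₀ y) j
  have h2 := congrFun (eval_constVec (B none) y) j
  simp only [tangentDir, Pi.sub_apply, Pi.smul_apply, smul_eq_mul, map_sub, map_mul, eval_polar,
    eval_linePt, eval_dirPt, eval_constVec, h1, h2, constVec_complex]

theorem eval_residualPt (y : Fin n → ℂ) : (fun j => eval y (residualPt F B i₀ i₁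
    (X : Fin n → MvPolynomial (Fin n) ℂ) j)) = residualPt F B i₀ i₁ y := by
  ext j
  have h1 := congrFun (eval_tangentDir F B i₀ i₁ y) j
  have h2 := congrFun (eval_linePt B i₀ i₁ y) j
  simp only [residualPt, Pi.sub_apply, Pi.smul_apply, smul_eq_mul, map_sub, map_mul, eval_polar,
    eval_linePt, eval_tangentDir, h1, h2, map_ofNat]

theorem isHomogeneous_constVec (v : Fin (n + 1) → ℂ) (j : Fin (n + 1)) :
    (constVec (MvPolynomial (Fin n) ℂ) v j).IsHomogeneous 0 := isHomogeneous_C _ _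

theorem isHomogeneous_linePt (j : Fin (n + 1)) :
    (linePt B i₀ i₁ (X : Fin n → MvPolynomial (Fin n) ℂ) j).IsHomogeneous 1 :=
  ((isHomogeneous_X ℂ i₀).mul (isHomogeneous_constVec _ j)).add
    ((isHomogeneous_X ℂ i₁).mul (isHomogeneous_constVec _ j))

theorem isHomogeneous_dirPt (j : Fin (n + 1)) :
    (dirPt B i₀ (X : Fin n → MvPolynomial (Fin n) ℂ) j).IsHomogeneous 1 := by
  simp only [dirPt, Finset.sum_apply, Pi.smul_apply, smul_eq_mul]
  refine IsHomogeneous.sum _ _ _ fun i _ => ?_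
  refine IsHomogeneous.mul (m := 1) (n := 0) ?_ (isHomogeneous_constVec _ j)
  split_ifs
  · exact isHomogeneous_zero _ _ _
  · exact isHomogeneous_X _ _

theorem isHomogeneous_tangentDir (j : Fin (n + 1)) :
    (tangentDir F B i₀ i₁ (X : Fin n → MvPolynomial (Fin n) ℂ) j).IsHomogeneous 3 := by
  have hp := isHomogeneous_linePt B i₀ i₁
  exact ((isHomogeneous_polar F hp hp (isHomogeneous_constVec _)).mul
    (isHomogeneous_dirPt B i₀ j)).sub ((isHomogeneous_polar F hp hp (isHomogeneous_dirPt B i₀)).mul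
      (isHomogeneous_constVec _ j))

theorem isHomogeneous_residualPt (j : Fin (n + 1)) :
    (residualPt F B i₀ i₁ (X : Fin n → MvPolynomial (Fin n) ℂ) j).IsHomogeneous 10 := by
  have hp := isHomogeneous_linePt B i₀ i₁
  have hd := isHomogeneous_tangentDir F B i₀ i₁
  have h3 : (3 : MvPolynomial (Fin n) ℂ).IsHomogeneous 0 := isHomogeneous_C _ (3 : ℂ)
  -- Degrees: `10 = (1 + 3 + 3) + 3 = (3 + 3 + 3) + 1`.
  exact ((h3.mul (isHomogeneous_polar F hp hd hd)).mul (hd j)).sub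
    ((isHomogeneous_polar F hd hd hd).mul (hp j))

section Points

variable {F B i₀ i₁}

theorem isSymm₃_polar : IsSymm₃ (polar F ℂ) := ⟨polar_swap₁₂ F, polar_swap₂₃ F⟩

theorem linePt_eq (y : Fin n → ℂ) :
    linePt B i₀ i₁ y = y i₀ • B (some i₀) + y i₁ • B (some i₁) := rfl

theorem polar_linePt_tangentDir (y : Fin n → ℂ) :
    polar F ℂ (linePt B i₀ i₁ y) (linePt B i₀ i₁ y) (tangentDir F B i₀ i₁ y) = 0 := by
  rw [tangentDir, map_sub, map_smul, map_smul, smul_eq_mul, smul_eq_mul]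
  ring

theorem polar_linePt_self (hW : VanishesOn (polar F ℂ) (B (some i₀)) (B (some i₁)))
    (y : Fin n → ℂ) :
    polar F ℂ (linePt B i₀ i₁ y) (linePt B i₀ i₁ y) (linePt B i₀ i₁ y) = 0 :=
  hW.apply isSymm₃_polar _ _ _ _ _ _

/-- Since `T p p p = T p p d = 0`, the cubic at `a • p + b • d` is `b ^ 2 * (3 * a * T p d d + b * T
d d d)`; the coefficients in `residualPt` make the linear factor vanish. -/
theorem polar_residualPt (hW : VanishesOn (polar F ℂ) (B (some i₀)) (B (some i₁)))
    (y : Fin n → ℂ) :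
    polar F ℂ (residualPt F B i₀ i₁ y) (residualPt F B i₀ i₁ y) (residualPt F B i₀ i₁ y) = 0 := by
  have hT := isSymm₃_polar (F := F)
  have h1 := polar_linePt_tangentDir (F := F) (B := B) (i₀ := i₀) (i₁ := i₁) y
  have h2 := polar_linePt_self hW y
  rw [residualPt]
  generalize tangentDir F B i₀ i₁ y = d at *
  generalize linePt B i₀ i₁ y = p at *
  rw [sub_eq_neg_add, ← neg_smul, hT.cube_add, h1, h2]
  ring

theorem polar_linePt_residualPt (hW : VanishesOn (polar F ℂ) (B (some i₀)) (B (some i₁)))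
    (y : Fin n → ℂ) :
    polar F ℂ (linePt B i₀ i₁ y) (linePt B i₀ i₁ y) (residualPt F B i₀ i₁ y) = 0 := by
  rw [residualPt, map_sub, map_smul, map_smul, polar_linePt_self hW, polar_linePt_tangentDir]
  simp

theorem coord_dirPt (y : Fin n → ℂ) (i : Fin n) :
    B.coord (some i) (dirPt B i₀ y) = if i = i₀ then 0 else y i := by
  rw [dirPt, map_sum]
  simp only [constVec_complex, map_smul, Module.Basis.coord_apply, Module.Basis.repr_self,
    smul_eq_mul]
  rw [Finset.sum_eq_single i]
  · simp
  · intro j _ hj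
    rw [Finsupp.single_eq_of_ne (by simpa using hj.symm), mul_zero]
  · simp

theorem coord_linePt (h01 : i₀ ≠ i₁) (y : Fin n → ℂ) (i : Fin n) :
    B.coord (some i) (linePt B i₀ i₁ y) = if i = i₀ then y i₀ else if i = i₁ then y i₁ else 0 := by
  simp only [linePt_eq, map_add, map_smul, Module.Basis.coord_apply, Module.Basis.repr_self,
    smul_eq_mul, Finsupp.single_apply, Option.some.injEq]
  rcases eq_or_ne i i₀ with rfl | hi
  · simp [h01.symm]
  · rcases eq_or_ne i i₁ with rfl | hi' <;> simp [*, Ne.symm]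

theorem coord_none_dirPt (y : Fin n → ℂ) : B.coord none (dirPt B i₀ y) = 0 := by
  rw [dirPt, map_sum]
  refine Finset.sum_eq_zero fun i _ => ?_
  rw [map_smul, constVec_complex, Module.Basis.coord_apply, Module.Basis.repr_self,
    Finsupp.single_eq_of_ne (by simp), smul_zero]

theorem coord_none_linePt (y : Fin n → ℂ) : B.coord none (linePt B i₀ i₁ y) = 0 := by
  simp [linePt_eq, Module.Basis.coord_apply]

theorem coord_none (i : Fin n) : B.coord (some i) (B none) = 0 := by
  simp [Module.Basis.coord_apply]

/-- The parameters can be recovered from the point and from the ratio `y i₀ : y i₁`. -/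
theorem mul_coord_residualPt (h01 : i₀ ≠ i₁) (y : Fin n → ℂ) {i : Fin n} (h0 : i ≠ i₀)
    (h1 : i ≠ i₁) :
    y i * (B.coord (some i₁) (residualPt F B i₀ i₁ y) * y i₀ -
      B.coord (some i₀) (residualPt F B i₀ i₁ y) * y i₁) =
    B.coord (some i) (residualPt F B i₀ i₁ y) * y i₀ * y i₁ := by
  simp only [residualPt, tangentDir, map_sub, map_smul, smul_eq_mul, coord_dirPt,
    coord_linePt h01, constVec_complex, coord_none, h0, h1, h01.symm, if_true, if_false]
  ring

/-- The points of the fibre of the parametrization. -/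
theorem exists_residualPt_eq (h01 : i₀ ≠ i₁)
    (hW : VanishesOn (polar F ℂ) (B (some i₀)) (B (some i₁)))
    {x : Fin (n + 1) → ℂ} {u v : ℂ} (hu : u ≠ 0) (hv : v ≠ 0)
    (hx : polar F ℂ x x x = 0)
    (hp : polar F ℂ (u • B (some i₀) + v • B (some i₁)) (u • B (some i₀) + v • B (some i₁)) x = 0)
    (he : polar F ℂ (u • B (some i₀) + v • B (some i₁)) (u • B (some i₀) + v • B (some i₁))
      (B none) ≠ 0)
    (hpx : polar F ℂ (u • B (some i₀) + v • B (some i₁)) x x ≠ 0)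
    (hm : B.coord (some i₁) x * u - B.coord (some i₀) x * v ≠ 0) :
    ∃ y : Fin n → ℂ, y i₀ = u ∧ y i₁ = v ∧ ∃ c : ℂ, c ≠ 0 ∧ residualPt F B i₀ i₁ y = c • x := by
  have hT := isSymm₃_polar (F := F)
  set s := B.coord (some i₀) x with hs
  set t := B.coord (some i₁) x with ht
  set κ := u * v / (t * u - s * v) with hκ
  have hκ0 : κ ≠ 0 := div_ne_zero (mul_ne_zero hu hv) hm
  -- The direction must be that of `x`, corrected by a multiple of `p` to kill the coordinate `i₀`.
  -- The factor `κ` makes its coordinate `i₁` equal to `v`, as the double role of `y i₁` demands.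
  let y : Fin n → ℂ := fun i => if i = i₀ then u else if i = i₁ then v else κ * B.coord (some i) x
  have hy0 : y i₀ = u := by simp [y]
  have hy1 : y i₁ = v := by simp [y, h01.symm]
  set p := u • B (some i₀) + v • B (some i₁) with hpdef
  have hline : linePt B i₀ i₁ y = p := by rw [linePt_eq, hy0, hy1]
  have hvκ : v = κ * (t - s / u * v) := by
    rw [hκ, div_mul_eq_mul_div, eq_div_iff hm]; field_simp
  have hdir : dirPt B i₀ y = κ • (x - (s / u) • p - B.coord none x • B none) := by
    refine B.ext_elem fun o => ?_
    change B.coord o _ = B.coord o _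
    rw [← hline]
    rcases o with _ | i
    · rw [map_smul, map_sub, map_sub, map_smul, map_smul, coord_none_dirPt, coord_none_linePt]
      simp
    · rw [map_smul, map_sub, map_sub, map_smul, map_smul, coord_dirPt, coord_linePt h01,
        coord_none]
      rcases eq_or_ne i i₀ with rfl | h0
      · simp only [if_true, hy0, smul_eq_mul, ← hs]
        field_simp
        ring
      rcases eq_or_ne i i₁ with rfl | h1
      · simp only [if_true, if_neg h0, hy1, smul_eq_mul, ← ht, mul_zero, sub_zero]
        exact hvκ
      · simp [y, h0, h1]
  have hpp : polar F ℂ p p p = 0 := hW.apply hT _ _ _ _ _ _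
  have hd : tangentDir F B i₀ i₁ y = (κ * polar F ℂ p p (B none)) • (x - (s / u) • p) := by
    rw [tangentDir, hline, hdir, constVec_complex]
    simp only [map_sub, map_smul, smul_eq_mul, hp, hpp]
    module
  refine ⟨y, hy0, hy1, ?_⟩
  set μ := κ * polar F ℂ p p (B none) with hμ
  have hμ0 : μ ≠ 0 := mul_ne_zero hκ0 he
  refine ⟨3 * μ ^ 3 * polar F ℂ p x x, mul_ne_zero (mul_ne_zero three_ne_zero
    (pow_ne_zero 3 hμ0)) hpx, ?_⟩
  have e1 : polar F ℂ p (x - (s / u) • p) (x - (s / u) • p) = polar F ℂ p x x := by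
    simp only [map_sub, map_smul, LinearMap.sub_apply, LinearMap.smul_apply, smul_eq_mul,
      hT.swap₂₃ p x p, hp, hpp]
    ring
  have e2 : polar F ℂ (x - (s / u) • p) (x - (s / u) • p) (x - (s / u) • p) =
      -3 * (s / u) * polar F ℂ p x x := by
    have := hT.cube_add 1 (-(s / u)) x p
    rw [one_smul, neg_smul, ← sub_eq_add_neg] at this
    rw [this, hx, hT.swap₁₃ x x p, hT.swap₁₃ x p p, hp, hpp]
    ring
  rw [residualPt, hline, hd]
  simp only [map_smul, LinearMap.smul_apply, smul_eq_mul, e1, e2]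
  module

end Points

end Construction

theorem aeval_mul_of_isHomogeneous {σ : Type} {S : Type*} [CommRing S] [Algebra ℂ S]
    {G : MvPolynomial σ ℂ} {d : ℕ} (hG : G.IsHomogeneous d) (c : S) (w : σ → S) :
    aeval (fun i => c * w i) G = c ^ d * aeval w G := by
  rw [aeval_def, aeval_def, eval₂_eq, eval₂_eq, Finset.mul_sum]
  refine Finset.sum_congr rfl fun m hm => ?_
  simp only [mul_pow, Finset.prod_mul_distrib, Finset.prod_pow_eq_pow_sum]
  rw [hG.degree_eq_sum_deg_support hm]
  ring

theorem eval_smul_of_isHomogeneous {σ : Type} {G : MvPolynomial σ ℂ} {d : ℕ}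
    (hG : G.IsHomogeneous d) (c : ℂ) (w : σ → ℂ) : eval (c • w) G = c ^ d * eval w G := by
  have := aeval_mul_of_isHomogeneous hG c w
  rwa [aeval_eq_eval, aeval_eq_eval] at this

/-! ### Existence of a point with two nondegenerate preimages -/

section Generic

variable {n : ℕ} {F : MvPolynomial (Fin (n + 1)) ℂ}
  {B : Module.Basis (Option (Fin n)) ℂ (Fin (n + 1) → ℂ)} {i₀ i₁ : Fin n}

/-- The line spanned by `B (some i₀)`, `B (some i₁)` lies on the cubic `F`, and `x` is a point of
the cubic both of whose preimages under the parametrization, at the points `(1 : 1)` and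
`(1 : -1)` of the line, are in general position. -/
structure IsGeneric (F : MvPolynomial (Fin (n + 1)) ℂ)
    (B : Module.Basis (Option (Fin n)) ℂ (Fin (n + 1) → ℂ)) (i₀ i₁ : Fin n)
    (x : Fin (n + 1) → ℂ) : Prop where
  ne : i₀ ≠ i₁
  vanish : VanishesOn (polar F ℂ) (B (some i₀)) (B (some i₁))
  cubic : polar F ℂ x x x = 0
  quad₀₀ : polar F ℂ (B (some i₀)) (B (some i₀)) x ≠ 0
  quad₀₁ : polar F ℂ (B (some i₀)) (B (some i₁)) x = 0
  quad₁₁ : polar F ℂ (B (some i₁)) (B (some i₁)) x = -polar F ℂ (B (some i₀)) (B (some i₀)) x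
  tangent_add : polar F ℂ (B (some i₀) + B (some i₁)) (B (some i₀) + B (some i₁)) (B none) ≠ 0
  tangent_sub : polar F ℂ (B (some i₀) - B (some i₁)) (B (some i₀) - B (some i₁)) (B none) ≠ 0
  polar_add : polar F ℂ (B (some i₀) + B (some i₁)) x x ≠ 0
  polar_sub : polar F ℂ (B (some i₀) - B (some i₁)) x x ≠ 0
  coord_sub : B.coord (some i₁) x - B.coord (some i₀) x ≠ 0
  coord_add : B.coord (some i₁) x + B.coord (some i₀) x ≠ 0

theorem exists_basis_of_linearIndependent {c₀ c₁ e : Fin (n + 1) → ℂ}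
    (h : LinearIndependent ℂ ![c₀, c₁, e]) :
    ∃ (B : Module.Basis (Option (Fin n)) ℂ (Fin (n + 1) → ℂ)) (i₀ i₁ : Fin n), i₀ ≠ i₁ ∧
      B (some i₀) = c₀ ∧ B (some i₁) = c₁ ∧ B none = e := by
  classical
  set B₀ := Module.Basis.sumExtend h with hB₀
  have hval : ∀ k, B₀ (Sum.inl k) = ![c₀, c₁, e] k := fun k => by
    simp [hB₀, Module.Basis.sumExtend]
    rfl
  have : Finite (Fin 3 ⊕ Module.Basis.sumExtendIndex h) := Module.Finite.finite_basis B₀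
  have := Fintype.ofFinite (Fin 3 ⊕ Module.Basis.sumExtendIndex h)
  have hcard : Fintype.card (Fin 3 ⊕ Module.Basis.sumExtendIndex h) =
      Fintype.card (Option (Fin n)) := by
    rw [← Module.finrank_eq_card_basis B₀]
    simp
  set φ₀ := Fintype.equivOfCardEq hcard
  -- The swap moves `e` to the index `none`.
  set φ := φ₀.trans (Equiv.swap (φ₀ (Sum.inl 2)) none) with hφ
  have h2 : φ (Sum.inl 2) = none := by simp [hφ]
  have hne : ∀ k, k ≠ 2 → ∃ i, φ (Sum.inl k) = some i := fun k hk => by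
    rw [← Option.ne_none_iff_exists', ← h2]
    exact fun h' => hk (Sum.inl_injective (φ.injective h'))
  obtain ⟨i₀, hi₀⟩ := hne 0 (by decide)
  obtain ⟨i₁, hi₁⟩ := hne 1 (by decide)
  refine ⟨B₀.reindex φ, i₀, i₁, ?_, ?_, ?_, ?_⟩
  · rintro rfl
    have := φ.injective (hi₀.trans hi₁.symm)
    simp at this
  · rw [← hi₀, Module.Basis.reindex_apply, Equiv.symm_apply_apply, hval]; rfl
  · rw [← hi₁, Module.Basis.reindex_apply, Equiv.symm_apply_apply, hval]; rfl
  · rw [← h2, Module.Basis.reindex_apply, Equiv.symm_apply_apply, hval]; rfl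

/-- The point `x` is taken on the residual conic, which meets the line in `p` and `q`; these are the
two points of the line whose tangent hyperplanes contain `x`. The basis of the line is `p + q`, `p -
q`, so that both have nonzero coordinates, `(1 : 1)` and `(1 : -1)`. -/
theorem exists_isGeneric (hs : IsSmooth₃ (polar F ℂ)) {b₀ b₁ : Fin (n + 1) → ℂ}
    (hb : LinearIndependent ℂ ![b₀, b₁]) (h : VanishesOn (polar F ℂ) b₀ b₁) :
    ∃ (B : Module.Basis (Option (Fin n)) ℂ (Fin (n + 1) → ℂ)) (i₀ i₁ : Fin n)
      (x : Fin (n + 1) → ℂ), IsGeneric F B i₀ i₁ x := by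
  have hT := isSymm₃_polar (F := F)
  set T := polar F ℂ with hTdef
  obtain ⟨p, q, z, hpq, hv, hp, hq, hτ, hdet⟩ := exists_transversal_plane hT hs hb h
  have hp0 : p ≠ 0 := hpq.ne_zero 0
  have hq0 : q ≠ 0 := hpq.ne_zero 1
  obtain ⟨e, hep, heq⟩ := exists_apply_ne_zero_pair (hs p hp0 hv.ppp) (hs q hq0 hv.qqq)
  have hli : LinearIndependent ℂ ![p + q, p - q, e] := by
    rw [LinearIndependent.pair_iff] at hpq
    rw [Fintype.linearIndependent_iff]
    intro g hg
    rw [Fin.sum_univ_three] at hg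
    simp only [Matrix.cons_val] at hg
    have h1 := congrArg (T p p) hg
    simp only [map_add, map_sub, map_smul, hv.ppp, hv.ppq, smul_eq_mul, map_zero, add_zero,
      sub_zero, mul_zero, zero_add, mul_eq_zero, hep, or_false] at h1
    rw [h1, zero_smul, add_zero] at hg
    obtain ⟨h2, h3⟩ := hpq (g 0 + g 1) (g 0 - g 1) (by rw [← hg]; module)
    intro i
    fin_cases i
    · change g 0 = 0; linear_combination (h2 + h3) / 2
    · change g 1 = 0; linear_combination (h2 - h3) / 2
    · exact h1
  obtain ⟨B, i₀, i₁, hne, hB0, hB1, hBe⟩ := exists_basis_of_linearIndependent hli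
  have hpB : p = (1 / 2 : ℂ) • (B (some i₀) + B (some i₁)) := by rw [hB0, hB1]; module
  have hqB : q = (1 / 2 : ℂ) • (B (some i₀) - B (some i₁)) := by rw [hB0, hB1]; module
  -- The excluded values are those at which the sum or the difference of the coordinates `i₀`, `i₁`
  -- of `x` vanishes.
  obtain ⟨α, β, hα, hβ, hx, hpx, hqx⟩ := exists_point_on_conic hT hv hp hq hτ hdet
    (-(B.coord (some i₁) z + B.coord (some i₀) z)) (B.coord (some i₁) z - B.coord (some i₀) z)
  have h10 : (some i₁ : Option (Fin n)) ≠ some i₀ := by simpa using hne.symm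
  have h01 : (some i₀ : Option (Fin n)) ≠ some i₁ := by simpa using hne
  have c0 : B.coord (some i₀) (α • p + β • q + z) = (α + β) / 2 + B.coord (some i₀) z := by
    rw [hpB, hqB]
    simp only [map_add, map_sub, map_smul, smul_eq_mul, Module.Basis.coord_apply,
      Module.Basis.repr_self, Finsupp.single_eq_same, Finsupp.single_eq_of_ne h01]
    ring
  have c1 : B.coord (some i₁) (α • p + β • q + z) = (α - β) / 2 + B.coord (some i₁) z := by
    rw [hpB, hqB]
    simp only [map_add, map_sub, map_smul, smul_eq_mul, Module.Basis.coord_apply,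
      Module.Basis.repr_self, Finsupp.single_eq_same, Finsupp.single_eq_of_ne h10]
    ring
  have epp : T p p (α • p + β • q + z) = 0 := by simp [hv.ppp, hv.ppq, hp]
  have eqq : T q q (α • p + β • q + z) = 0 := by
    simp [hv.qqq, hT.swap₁₃ q q p, hv.pqq, hq]
  have epq : T p q (α • p + β • q + z) = T p q z := by
    simp [hT.swap₂₃ p q p, hv.ppq, hv.pqq]
  generalize α • p + β • q + z = x at *
  have hadd : p + q + (p - q) = (2 : ℂ) • p := by module
  have hsub : p + q - (p - q) = (2 : ℂ) • q := by module
  refine ⟨B, i₀, i₁, x, hne, ?_, hx, ?_, ?_, ?_, ?_, ?_, ?_, ?_, ?_, ?_⟩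
  · rw [hB0, hB1]
    have e1 : p + q = (1 : ℂ) • p + (1 : ℂ) • q := by module
    have e2 : p - q = (1 : ℂ) • p + (-1 : ℂ) • q := by module
    rw [e1, e2]
    exact ⟨hv.apply hT _ _ _ _ _ _, hv.apply hT _ _ _ _ _ _, hv.apply hT _ _ _ _ _ _,
      hv.apply hT _ _ _ _ _ _⟩
  · rw [hB0, ← hTdef]
    simp only [map_add, LinearMap.add_apply, epp, eqq, hT.swap₁₂ q p x, epq, zero_add, add_zero]
    rw [← two_mul]
    exact mul_ne_zero two_ne_zero hτ
  · rw [hB0, hB1, ← hTdef]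
    simp only [map_add, map_sub, LinearMap.add_apply, LinearMap.sub_apply, epp, eqq,
      hT.swap₁₂ q p x]
    ring
  · rw [hB0, hB1, ← hTdef]
    simp only [map_add, map_sub, LinearMap.add_apply, LinearMap.sub_apply, epp, eqq,
      hT.swap₁₂ q p x]
    ring
  · rw [hB0, hB1, hBe, hadd]
    simpa using hep
  · rw [hB0, hB1, hBe, hsub]
    simpa using heq
  · rw [hB0, hB1, hadd]
    simpa using hpx
  · rw [hB0, hB1, hsub]
    simpa using hqx
  · rw [c0, c1]
    exact fun h0 => hβ (by linear_combination -h0)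
  · rw [c0, c1]
    exact fun h0 => hα (by linear_combination h0)

end Generic

/-! ### The two preimages of a general point -/

section Degree

variable {n : ℕ} {F : MvPolynomial (Fin (n + 1)) ℂ}
  {B : Module.Basis (Option (Fin n)) ℂ (Fin (n + 1) → ℂ)} {i₀ i₁ : Fin n} {x : Fin (n + 1) → ℂ}

variable (F B i₀ i₁) in
/-- The forms that define the parametrization. -/
abbrev paramForm : Fin (n + 1) → MvPolynomial (Fin n) ℂ := residualPt F B i₀ i₁ X

variable (F B i₀ i₁) in
/-- The pullback of a linear form under the parametrization. -/
def pullForm (l : (Fin (n + 1) → ℂ) →ₗ[ℂ] ℂ) : MvPolynomial (Fin n) ℂ :=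
  aeval (paramForm F B i₀ i₁) (linearForm l)

theorem eval_pullForm (l : (Fin (n + 1) → ℂ) →ₗ[ℂ] ℂ) (y : Fin n → ℂ) :
    eval y (pullForm F B i₀ i₁ l) = l (residualPt F B i₀ i₁ y) := by
  rw [pullForm, eval_aeval, eval_residualPt, eval_linearForm]

theorem exists_eval_ne_zero {σ : Type} {P : MvPolynomial σ ℂ} (hP : P ≠ 0) :
    ∃ y, eval y P ≠ 0 := by
  by_contra! h
  exact hP (MvPolynomial.funext fun y => by rw [h, map_zero])

theorem ne_zero_of_eval {σ : Type} {P : MvPolynomial σ ℂ} {y : σ → ℂ} (h : eval y P ≠ 0) :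
    P ≠ 0 := fun h0 => h (by rw [h0, map_zero])

theorem IsGeneric.exists_preimage (h : IsGeneric F B i₀ i₁ x) :
    ∃ y : Fin n → ℂ, y i₀ = 1 ∧ y i₁ = 1 ∧ ∃ c : ℂ, c ≠ 0 ∧ residualPt F B i₀ i₁ y = c • x := by
  refine exists_residualPt_eq h.ne h.vanish one_ne_zero one_ne_zero h.cubic ?_ ?_ ?_ ?_
  · rw [isSymm₃_polar.sq_add, h.quad₀₁, h.quad₁₁]; ring
  · simpa only [one_smul] using h.tangent_add
  · simpa only [one_smul] using h.polar_add
  · simpa only [mul_one] using h.coord_sub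

theorem IsGeneric.pullForm_quad_ne_zero (h : IsGeneric F B i₀ i₁ x) :
    pullForm F B i₀ i₁ (polar F ℂ (B (some i₀)) (B (some i₀))) ≠ 0 := by
  obtain ⟨y, -, -, c, hc, hy⟩ := h.exists_preimage
  refine ne_zero_of_eval (y := y) ?_
  rw [eval_pullForm, hy, map_smul]
  exact mul_ne_zero hc h.quad₀₀

theorem IsGeneric.pullForm_coord_ne_zero (h : IsGeneric F B i₀ i₁ x) :
    pullForm F B i₀ i₁ (B.coord (some i₁)) * X i₀ - pullForm F B i₀ i₁ (B.coord (some i₀)) * X i₁ ≠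
      0 := by
  obtain ⟨y, h0, h1, c, hc, hy⟩ := h.exists_preimage
  refine ne_zero_of_eval (y := y) ?_
  simp only [map_sub, map_mul, eval_pullForm, eval_X, hy, h0, h1, mul_one, map_smul, smul_eq_mul]
  rw [← mul_sub]
  exact mul_ne_zero hc h.coord_sub

/-- This is the tangency condition `T p p x = 0` at the residual point, with `p` expanded in the
basis of the line. -/
theorem IsGeneric.quadratic_relation (h : IsGeneric F B i₀ i₁ x) :
    pullForm F B i₀ i₁ (polar F ℂ (B (some i₀)) (B (some i₀))) * X i₀ ^ 2 +
      2 * pullForm F B i₀ i₁ (polar F ℂ (B (some i₀)) (B (some i₁))) * X i₀ * X i₁ +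
      pullForm F B i₀ i₁ (polar F ℂ (B (some i₁)) (B (some i₁))) * X i₁ ^ 2 = 0 := by
  refine MvPolynomial.funext fun y => ?_
  have := polar_linePt_residualPt h.vanish y
  rw [linePt_eq, isSymm₃_polar.sq_add] at this
  simp only [map_add, map_mul, map_pow, eval_pullForm, eval_X, map_ofNat, map_zero]
  linear_combination this

theorem IsGeneric.mul_coord (h : IsGeneric F B i₀ i₁ x) {i : Fin n} (h0 : i ≠ i₀) (h1 : i ≠ i₁) :
    X i * (pullForm F B i₀ i₁ (B.coord (some i₁)) * X i₀ -
      pullForm F B i₀ i₁ (B.coord (some i₀)) * X i₁) =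
      pullForm F B i₀ i₁ (B.coord (some i)) * X i₀ * X i₁ := by
  refine MvPolynomial.funext fun y => ?_
  simp only [map_sub, map_mul, eval_pullForm, eval_X]
  exact mul_coord_residualPt h.ne y h0 h1

/-- The ratio `y i₀ : y i₁` is not a rational function of the point, because the general point has
two preimages, which differ in this ratio. -/
theorem IsGeneric.ratio_ne (h : IsGeneric F B i₀ i₁ x) {d : ℕ}
    {P Q : MvPolynomial (Fin (n + 1)) ℂ} (hP : P.IsHomogeneous d) (hQ : Q.IsHomogeneous d)
    (hQ0 : aeval (paramForm F B i₀ i₁) Q ≠ 0) :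
    X i₀ * aeval (paramForm F B i₀ i₁) Q ≠ X i₁ * aeval (paramForm F B i₀ i₁) P := by
  intro heq
  have hT := isSymm₃_polar (F := F)
  let a : MvPolynomial (Fin n) ℂ := pullForm F B i₀ i₁ (polar F ℂ (B (some i₀)) (B (some i₀)))
  let c : MvPolynomial (Fin n) ℂ := pullForm F B i₀ i₁ (polar F ℂ (B (some i₁)) (B (some i₁)))
  let s : MvPolynomial (Fin n) ℂ := pullForm F B i₀ i₁ (B.coord (some i₀))
  let t : MvPolynomial (Fin n) ℂ := pullForm F B i₀ i₁ (B.coord (some i₁))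
  -- By Vieta, the second root of the quadratic for `y i₀ : y i₁` is `c * y i₁ : a * y i₀`.
  let p' : Fin (n + 1) → MvPolynomial (Fin n) ℂ :=
    (c * X i₁) • constVec _ (B (some i₀)) + (a * X i₀) • constVec _ (B (some i₁))
  have hp' : ∀ y, (fun j => eval y (p' j)) = (eval y c * y i₁) • B (some i₀) +
      (eval y a * y i₀) • B (some i₁) := fun y => by
    ext j; simp [p', constVec, MvPolynomial.algebraMap_eq]
  -- Where `N` is nonzero, the two roots differ and the second one satisfies the hypotheses of
  -- `exists_residualPt_eq`.
  let N : MvPolynomial (Fin n) ℂ := X i₀ * X i₁ * a * c * (a * X i₀ ^ 2 - c * X i₁ ^ 2) *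
    polar F _ p' p' (constVec _ (B none)) *
    polar F _ p' (paramForm F B i₀ i₁) (paramForm F B i₀ i₁) *
    (t * (c * X i₁) - s * (a * X i₀))
  have hN : ∀ y, eval y N = y i₀ * y i₁ * eval y a * eval y c *
      (eval y a * y i₀ ^ 2 - eval y c * y i₁ ^ 2) *
      polar F ℂ ((eval y c * y i₁) • B (some i₀) + (eval y a * y i₀) • B (some i₁))
        ((eval y c * y i₁) • B (some i₀) + (eval y a * y i₀) • B (some i₁)) (B none) *
      polar F ℂ ((eval y c * y i₁) • B (some i₀) + (eval y a * y i₀) • B (some i₁))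
        (residualPt F B i₀ i₁ y) (residualPt F B i₀ i₁ y) *
      (B.coord (some i₁) (residualPt F B i₀ i₁ y) * (eval y c * y i₁) -
        B.coord (some i₀) (residualPt F B i₀ i₁ y) * (eval y a * y i₀)) := fun y => by
    simp only [N, map_mul, map_sub, map_pow, eval_X, eval_polar, hp', eval_constVec,
      eval_residualPt, s, t, eval_pullForm]
  have hN0 : N ≠ 0 := by
    obtain ⟨y, h0, h1, k, hk, hy⟩ := h.exists_preimage
    refine ne_zero_of_eval (y := y) ?_
    have ha : eval y a = k * polar F ℂ (B (some i₀)) (B (some i₀)) x := by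
      simp only [a, eval_pullForm, hy, map_smul, smul_eq_mul]
    have hc : eval y c = -(k * polar F ℂ (B (some i₀)) (B (some i₀)) x) := by
      simp only [c, eval_pullForm, hy, map_smul, smul_eq_mul, h.quad₁₁, mul_neg]
    have hm : k * polar F ℂ (B (some i₀)) (B (some i₀)) x ≠ 0 := mul_ne_zero hk h.quad₀₀
    rw [hN, h0, h1, ha, hc, hy]
    generalize k * polar F ℂ (B (some i₀)) (B (some i₀)) x = m at hm
    have e1 : (-m * 1) • B (some i₀) + (m * 1) • B (some i₁) =
        (-m) • (B (some i₀) - B (some i₁)) := by module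
    rw [e1]
    simp only [map_smul, LinearMap.smul_apply, smul_eq_mul]
    refine mul_ne_zero (mul_ne_zero (mul_ne_zero (mul_ne_zero ?_ ?_) ?_) ?_) ?_
    · simpa using hm
    · have : m * 1 ^ 2 - -m * 1 ^ 2 = 2 * m := by ring
      rw [this]; exact mul_ne_zero two_ne_zero hm
    · exact mul_ne_zero (neg_ne_zero.2 hm) (mul_ne_zero (neg_ne_zero.2 hm) h.tangent_sub)
    · exact mul_ne_zero hk (mul_ne_zero hk (mul_ne_zero (neg_ne_zero.2 hm) h.polar_sub))
    · have e2 : k * B.coord (some i₁) x * (-m * 1) - k * B.coord (some i₀) x * (m * 1) =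
          -(k * m * (B.coord (some i₁) x + B.coord (some i₀) x)) := by ring
      rw [e2]
      exact neg_ne_zero.2 (mul_ne_zero (mul_ne_zero hk hm) h.coord_add)
  obtain ⟨y, hy⟩ := exists_eval_ne_zero (mul_ne_zero hN0 hQ0)
  rw [map_mul, hN] at hy
  simp only [ne_eq, mul_eq_zero, not_or] at hy
  obtain ⟨⟨⟨⟨⟨⟨⟨⟨hy0, hy1⟩, ha⟩, hc⟩, hac⟩, he⟩, hpx⟩, hst⟩, hQy⟩ := hy
  have hquad := congrArg (eval y) h.quadratic_relation
  have e3 := congrArg (eval y) heq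
  simp only [map_mul, eval_X, eval_aeval, eval_residualPt] at e3
  rw [eval_aeval, eval_residualPt] at hQy
  obtain ⟨y', hy0', hy1', k, hk, hres⟩ := exists_residualPt_eq h.ne h.vanish
    (mul_ne_zero hc hy1) (mul_ne_zero ha hy0) (polar_residualPt h.vanish y) (by
      rw [hT.sq_add]
      simp only [map_add, map_mul, map_pow, eval_X, eval_pullForm, map_ofNat, map_zero] at hquad
      simp only [a, c, eval_pullForm]
      linear_combination (polar F ℂ (B (some i₀)) (B (some i₀)) (residualPt F B i₀ i₁ y) *
        polar F ℂ (B (some i₁)) (B (some i₁)) (residualPt F B i₀ i₁ y)) * hquad) he hpx hst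
  have e4 := congrArg (eval y') heq
  simp only [map_mul, eval_X, eval_aeval, eval_residualPt, hres, hy0', hy1',
    eval_smul_of_isHomogeneous hP, eval_smul_of_isHomogeneous hQ] at e4
  have e5 := mul_left_cancel₀ (pow_ne_zero d hk)
    (show k ^ d * (eval y c * y i₁ * eval (residualPt F B i₀ i₁ y) Q) =
      k ^ d * (eval y a * y i₀ * eval (residualPt F B i₀ i₁ y) P) by linear_combination e4)
  -- `P / Q` takes the same value at the proportional images of `y` and `y'`, so the two roots would
  -- coincide.
  have e6 : (eval y a * y i₀ ^ 2 - eval y c * y i₁ ^ 2) * eval (residualPt F B i₀ i₁ y) Q = 0 := by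
    linear_combination eval y a * y i₀ * e3 - y i₁ * e5
  exact (mul_ne_zero hac hQy) e6

end Degree

/-! ### The extension of function fields -/

section FunctionField

/-- The embedding of the polynomials into the rational functions. -/
abbrev toFrac (σ : Type) : MvPolynomial σ ℂ →+* FractionRing (MvPolynomial σ ℂ) :=
  algebraMap _ _

theorem toFrac_injective (σ : Type) : Function.Injective (toFrac σ) := IsFractionRing.injective _ _

theorem toFrac_X_ne_zero {σ : Type} (j : σ) : toFrac σ (X j) ≠ 0 :=
  (map_ne_zero_iff _ (toFrac_injective σ)).2 (X_ne_zero j)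

theorem finrank_adjoin_eq_two {E K : Type*} [Field E] [Field K] [Algebra E K] {r : K}
    (hr : r ∉ (algebraMap E K).range) {b c : E}
    (h : r ^ 2 + algebraMap E K b * r + algebraMap E K c = 0) :
    Module.finrank E (IntermediateField.adjoin E {r}) = 2 := by
  set P : Polynomial E := Polynomial.X ^ 2 + Polynomial.C b * Polynomial.X + Polynomial.C c with hP
  have hPdeg : P.natDegree = 2 := by rw [hP]; compute_degree!
  have hPmonic : P.Monic := by rw [hP]; monicity!
  have hPr : Polynomial.aeval r P = 0 := by simpa [hP] using h
  have hint : IsIntegral E r := ⟨P, hPmonic, hPr⟩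
  rw [IntermediateField.adjoin.finrank hint]
  refine le_antisymm ?_ ((minpoly.two_le_natDegree_iff hint).2 hr)
  rw [← hPdeg]
  exact Polynomial.natDegree_le_of_dvd (minpoly.dvd E r hPr) hPmonic.ne_zero

theorem finrank_extendScalars_eq_two {k K : Type*} [Field k] [Field K] [Algebra k K]
    {E L : IntermediateField k K} (hEL : E ≤ L) {r : K} (hrL : r ∈ L) (hrE : r ∉ E)
    (hL : ∀ S : IntermediateField k K, E ≤ S → r ∈ S → L ≤ S) {b c : E}
    (h : r ^ 2 + algebraMap E K b * r + algebraMap E K c = 0) :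
    Module.finrank E (IntermediateField.extendScalars hEL) = 2 := by
  have heq : IntermediateField.extendScalars hEL = IntermediateField.adjoin E {r} := by
    refine le_antisymm ?_ ?_
    · rw [IntermediateField.extendScalars_le_iff]
      refine hL _ (fun y hy => ?_) (IntermediateField.mem_adjoin_simple_self E r)
      exact (IntermediateField.adjoin E {r}).algebraMap_mem (⟨y, hy⟩ : E)
    · rw [IntermediateField.adjoin_simple_le_iff]
      exact hrL
  rw [heq]
  refine finrank_adjoin_eq_two ?_ h
  rintro ⟨y, rfl⟩
  exact hrE y.2

theorem aeval_mem_intermediateField {σ : Type} {K : Type*} [Field K] [Algebra ℂ K]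
    (S : IntermediateField ℂ K) {w : σ → K} (hw : ∀ i, w i ∈ S) (G : MvPolynomial σ ℂ) :
    aeval w G ∈ S := by
  have h1 : aeval w G ∈ Algebra.adjoin ℂ (Set.range w) := by
    rw [Algebra.adjoin_range_eq_range_aeval]; exact ⟨G, rfl⟩
  have h2 : Algebra.adjoin ℂ (Set.range w) ≤ S.toSubalgebra :=
    Algebra.adjoin_le (by rintro _ ⟨i, rfl⟩; exact hw i)
  exact h2 h1

/-- Dehomogenization with respect to the coordinate `j`. -/
theorem algebraMap_eq_pow_mul_aeval {σ : Type} {G : MvPolynomial σ ℂ} {d : ℕ}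
    (hG : G.IsHomogeneous d) (j : σ) :
    toFrac σ G =
      toFrac σ (X j) ^ d *
        aeval (fun i => toFrac σ (X i) /
          toFrac σ (X j)) G := by
  have hj := toFrac_X_ne_zero j
  rw [← aeval_mul_of_isHomogeneous hG]
  have h1 : (fun i => toFrac σ (X j) *
      (toFrac σ (X i) /
        toFrac σ (X j))) =
      fun i => IsScalarTower.toAlgHom ℂ (MvPolynomial σ ℂ) (FractionRing (MvPolynomial σ ℂ))
        (X i) := by
    ext i
    rw [mul_div_cancel₀ _ hj]
    rfl
  rw [h1]
  have h2 := comp_aeval_apply X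
    (IsScalarTower.toAlgHom ℂ (MvPolynomial σ ℂ) (FractionRing (MvPolynomial σ ℂ))) G
  rw [← h2, aeval_X_left_apply]
  rfl

/-- The function field of the projective space is generated by the ratios of coordinates. -/
theorem functionField_le {σ : Type} (j : σ)
    (S : IntermediateField ℂ (FractionRing (MvPolynomial σ ℂ)))
    (hS : ∀ i, toFrac σ (X i) /
      toFrac σ (X j) ∈ S) : functionField σ ≤ S := by
  intro x hx
  obtain ⟨d, P, Q, hP, hQ, hQ0, rfl⟩ := (mem_functionField x).1 hx
  have hj := toFrac_X_ne_zero j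
  rw [algebraMap_eq_pow_mul_aeval hP j, algebraMap_eq_pow_mul_aeval hQ j,
    mul_div_mul_left _ _ (pow_ne_zero d hj)]
  exact div_mem (aeval_mem_intermediateField S hS P) (aeval_mem_intermediateField S hS Q)

theorem div_mem_functionField {σ : Type} (i j : σ) :
    toFrac σ (X i) /
      toFrac σ (X j) ∈ functionField σ :=
  (mem_functionField _).2 ⟨1, X i, X j, isHomogeneous_X _ _, isHomogeneous_X _ _, X_ne_zero j, rfl⟩

variable {n : ℕ} {F : MvPolynomial (Fin (n + 1)) ℂ}
  {B : Module.Basis (Option (Fin n)) ℂ (Fin (n + 1) → ℂ)} {i₀ i₁ : Fin n} {x : Fin (n + 1) → ℂ}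

theorem IsGeneric.exists_paramForm_ne_zero (h : IsGeneric F B i₀ i₁ x) :
    ∃ i, paramForm F B i₀ i₁ i ≠ 0 := by
  by_contra! H
  obtain ⟨y, -, -, c, hc, hy⟩ := h.exists_preimage
  have hx : x ≠ 0 := fun h0 => h.quad₀₀ (by rw [h0, map_zero])
  refine smul_ne_zero hc hx ?_
  rw [← hy, ← eval_residualPt]
  ext j
  have : residualPt F B i₀ i₁ (X : Fin n → MvPolynomial (Fin n) ℂ) j = 0 := H j
  simp [this]

/-- The parametrization of the cubic. -/
def IsGeneric.ratMap (h : IsGeneric F B i₀ i₁ x) : ProjRatMap (Fin n) (Fin (n + 1)) where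
  deg := 10
  form := paramForm F B i₀ i₁
  isHomogeneous := isHomogeneous_residualPt F B i₀ i₁
  exists_ne_zero := h.exists_paramForm_ne_zero

theorem IsGeneric.div_mem (h : IsGeneric F B i₀ i₁ x) (l l' : (Fin (n + 1) → ℂ) →ₗ[ℂ] ℂ)
    (hl' : pullForm F B i₀ i₁ l' ≠ 0) :
    toFrac (Fin n) (pullForm F B i₀ i₁ l) /
      toFrac (Fin n) (pullForm F B i₀ i₁ l') ∈
      h.ratMap.pullbackField :=
  ⟨1, linearForm l, linearForm l', isHomogeneous_linearForm l, isHomogeneous_linearForm l', hl', rfl⟩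

/-- Any field that contains the pulled back functions and the ratio `y i₀ : y i₁` contains all
ratios of coordinates. -/
theorem IsGeneric.ratio_mem (h : IsGeneric F B i₀ i₁ x)
    (S : IntermediateField ℂ (FractionRing (MvPolynomial (Fin n) ℂ)))
    (hS : h.ratMap.pullbackField ≤ S)
    (hr : toFrac (Fin n) (X i₀) /
      toFrac (Fin n) (X i₁) ∈ S) (i : Fin n) :
    toFrac (Fin n) (X i) /
      toFrac (Fin n) (X i₁) ∈ S := by
  set φ := toFrac (Fin n) with hφ
  have hinj : Function.Injective φ := toFrac_injective _
  have h1 : φ (X i₁) ≠ 0 := toFrac_X_ne_zero i₁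
  rcases eq_or_ne i i₀ with rfl | hi0
  · exact hr
  rcases eq_or_ne i i₁ with rfl | hi1
  · rw [div_self h1]; exact one_mem S
  set a := φ (pullForm F B i₀ i₁ (polar F ℂ (B (some i₀)) (B (some i₀)))) with ha
  have ha0 : a ≠ 0 := (map_ne_zero_iff _ hinj).2 h.pullForm_quad_ne_zero
  have hrel := congrArg φ (h.mul_coord hi0 hi1)
  have hm : φ (_ : MvPolynomial (Fin n) ℂ) ≠ 0 :=
    (map_ne_zero_iff _ hinj).2 h.pullForm_coord_ne_zero
  simp only [map_mul, map_sub] at hrel hm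
  have hl : ∀ l, φ (pullForm F B i₀ i₁ l) / a ∈ S := fun l =>
    hS (h.div_mem l _ h.pullForm_quad_ne_zero)
  -- This solves `IsGeneric.mul_coord` for `X i`, after division by `a` to obtain ratios of forms of
  -- equal degree.
  have key : φ (X i) / φ (X i₁) =
      (φ (pullForm F B i₀ i₁ (B.coord (some i))) / a * (φ (X i₀) / φ (X i₁))) /
        (φ (pullForm F B i₀ i₁ (B.coord (some i₁))) / a * (φ (X i₀) / φ (X i₁)) -
          φ (pullForm F B i₀ i₁ (B.coord (some i₀))) / a) := by
    have e : φ (pullForm F B i₀ i₁ (B.coord (some i₁))) / a * (φ (X i₀) / φ (X i₁)) -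
          φ (pullForm F B i₀ i₁ (B.coord (some i₀))) / a =
        (φ (pullForm F B i₀ i₁ (B.coord (some i₁))) * φ (X i₀) -
          φ (pullForm F B i₀ i₁ (B.coord (some i₀))) * φ (X i₁)) / (a * φ (X i₁)) := by
      field_simp
    rw [e, eq_div_iff (div_ne_zero hm (mul_ne_zero ha0 h1))]
    field_simp
    linear_combination hrel
  rw [key]
  exact _root_.div_mem (mul_mem (hl _) hr) (sub_mem (mul_mem (hl _) hr) (hl _))

theorem IsGeneric.ratio_quadratic (h : IsGeneric F B i₀ i₁ x) :
    ∃ b c : h.ratMap.pullbackField,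
      (toFrac (Fin n) (X i₀) /
        toFrac (Fin n) (X i₁)) ^ 2 +
      algebraMap h.ratMap.pullbackField _ b *
        (toFrac (Fin n) (X i₀) /
          toFrac (Fin n) (X i₁)) +
      algebraMap h.ratMap.pullbackField _ c = 0 := by
  set φ := toFrac (Fin n) with hφ
  have hinj : Function.Injective φ := toFrac_injective _
  have h1 : φ (X i₁) ≠ 0 := toFrac_X_ne_zero i₁
  have ha0 : φ (pullForm F B i₀ i₁ (polar F ℂ (B (some i₀)) (B (some i₀)))) ≠ 0 :=
    (map_ne_zero_iff _ hinj).2 h.pullForm_quad_ne_zero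
  have hrel := congrArg φ h.quadratic_relation
  simp only [map_mul, map_add, map_pow, map_ofNat, map_zero] at hrel
  refine ⟨2 * ⟨_, h.div_mem (polar F ℂ (B (some i₀)) (B (some i₁))) _ h.pullForm_quad_ne_zero⟩,
    ⟨_, h.div_mem (polar F ℂ (B (some i₁)) (B (some i₁))) _ h.pullForm_quad_ne_zero⟩, ?_⟩
  simp only [map_mul, map_ofNat, IntermediateField.algebraMap_apply, ← hφ]
  field_simp
  linear_combination hrel

theorem IsGeneric.ratio_notMem (h : IsGeneric F B i₀ i₁ x) :
    toFrac (Fin n) (X i₀) /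
      toFrac (Fin n) (X i₁) ∉ h.ratMap.pullbackField := by
  rintro ⟨d, P, Q, hP, hQ, hQ0, heq⟩
  have hinj := toFrac_injective (Fin n)
  refine h.ratio_ne hP hQ hQ0 (hinj ?_)
  rw [div_eq_div_iff ((map_ne_zero_iff _ hinj).2 (X_ne_zero _))
    ((map_ne_zero_iff _ hinj).2 hQ0)] at heq
  rw [map_mul, map_mul]
  exact heq.trans (mul_comm _ _)

theorem IsGeneric.degree_ratMap (h : IsGeneric F B i₀ i₁ x) : h.ratMap.degree = 2 := by
  obtain ⟨b, c, hbc⟩ := h.ratio_quadratic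
  exact finrank_extendScalars_eq_two h.ratMap.pullbackField_le (div_mem_functionField i₀ i₁)
    h.ratio_notMem (fun S hS hr => functionField_le i₁ S (h.ratio_mem S hS hr)) hbc

end FunctionField

/-! ### Density of the image -/

section Dominance

/-- The rational functions that are algebraic over a ring of polynomials. -/
def algebraicOver {σ : Type} (A : Subalgebra ℂ (MvPolynomial σ ℂ)) :
    IntermediateField ℂ (FractionRing (MvPolynomial σ ℂ)) where
  carrier := {x | IsAlgebraic A x}
  mul_mem' := IsAlgebraic.mul
  add_mem' := IsAlgebraic.add
  algebraMap_mem' c := by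
    rw [Set.mem_ofPred_eq, IsScalarTower.algebraMap_apply ℂ A]
    exact isAlgebraic_algebraMap _
  inv_mem' _ := IsAlgebraic.inv

theorem mem_algebraicOver {σ : Type} {A : Subalgebra ℂ (MvPolynomial σ ℂ)}
    {x : FractionRing (MvPolynomial σ ℂ)} : x ∈ algebraicOver A ↔ IsAlgebraic A x := Iff.rfl

theorem toFrac_mem_algebraicOver {σ : Type} {A : Subalgebra ℂ (MvPolynomial σ ℂ)}
    {P : MvPolynomial σ ℂ} (hP : P ∈ A) : toFrac σ P ∈ algebraicOver A :=
  isAlgebraic_algebraMap (⟨P, hP⟩ : A)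

variable {n : ℕ} {F : MvPolynomial (Fin (n + 1)) ℂ}
  {B : Module.Basis (Option (Fin n)) ℂ (Fin (n + 1) → ℂ)} {i₀ i₁ : Fin n} {x : Fin (n + 1) → ℂ}

theorem pullForm_mem (l : (Fin (n + 1) → ℂ) →ₗ[ℂ] ℂ) :
    pullForm F B i₀ i₁ l ∈ (aeval (R := ℂ) (paramForm F B i₀ i₁)).range := ⟨_, rfl⟩

theorem IsGeneric.ratio_mem_algebraicOver (h : IsGeneric F B i₀ i₁ x) :
    toFrac (Fin n) (X i₀) / toFrac (Fin n) (X i₁) ∈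
      algebraicOver (aeval (R := ℂ) (paramForm F B i₀ i₁)).range := by
  set A := (aeval (R := ℂ) (paramForm F B i₀ i₁)).range
  let q : Fin n → Fin n → A := fun i j =>
    ⟨pullForm F B i₀ i₁ (polar F ℂ (B (some i)) (B (some j))), pullForm_mem _⟩
  have hq : ∀ i j, algebraMap A (FractionRing (MvPolynomial (Fin n) ℂ)) (q i j) =
      toFrac (Fin n) (pullForm F B i₀ i₁ (polar F ℂ (B (some i)) (B (some j)))) := fun i j => rfl
  have hq0 : q i₀ i₀ ≠ 0 := fun h0 => h.pullForm_quad_ne_zero (congrArg Subtype.val h0)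
  refine ⟨Polynomial.C (q i₀ i₀) * Polynomial.X ^ 2 + Polynomial.C (2 * q i₀ i₁) * Polynomial.X +
    Polynomial.C (q i₁ i₁), fun h0 => hq0 ?_, ?_⟩
  · have := congrArg (Polynomial.coeff · 2) h0
    simpa [Polynomial.coeff_X, Polynomial.coeff_C] using this
  · have hrel := congrArg (toFrac (Fin n)) h.quadratic_relation
    have h1 := toFrac_X_ne_zero i₁
    simp only [map_mul, map_add, map_pow, map_ofNat, map_zero] at hrel
    simp only [map_add, map_mul, map_pow, Polynomial.aeval_C, Polynomial.aeval_X, hq, map_ofNat]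
    field_simp
    linear_combination hrel

theorem IsGeneric.pullbackField_le_algebraicOver (h : IsGeneric F B i₀ i₁ x) :
    h.ratMap.pullbackField ≤ algebraicOver (aeval (R := ℂ) (paramForm F B i₀ i₁)).range := by
  rintro _ ⟨d, P, Q, -, -, -, rfl⟩
  exact _root_.div_mem (toFrac_mem_algebraicOver ⟨P, rfl⟩) (toFrac_mem_algebraicOver ⟨Q, rfl⟩)

/-- The ratios of coordinates are algebraic over the ring of the parametrizing forms. A nonzero form
of degree 10 in that ring is `X i₁ ^ 10` times a polynomial in these ratios, so `X i₁` is algebraic,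
and then so is every coordinate. -/
theorem IsGeneric.isAlgebraic_X (h : IsGeneric F B i₀ i₁ x) (i : Fin n) :
    IsAlgebraic (aeval (R := ℂ) (paramForm F B i₀ i₁)).range (X i : MvPolynomial (Fin n) ℂ) := by
  set A := (aeval (R := ℂ) (paramForm F B i₀ i₁)).range
  have hw : ∀ i, toFrac (Fin n) (X i) / toFrac (Fin n) (X i₁) ∈ algebraicOver A :=
    h.ratio_mem _ h.pullbackField_le_algebraicOver h.ratio_mem_algebraicOver
  set P := pullForm F B i₀ i₁ (polar F ℂ (B (some i₀)) (B (some i₀))) with hP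
  have hhom : P.IsHomogeneous (10 * 1) :=
    (isHomogeneous_linearForm _).aeval _ (isHomogeneous_residualPt F B i₀ i₁)
  have hPeq := algebraMap_eq_pow_mul_aeval hhom i₁
  have hP0 : toFrac (Fin n) P ≠ 0 :=
    (map_ne_zero_iff _ (toFrac_injective _)).2 h.pullForm_quad_ne_zero
  have hval : toFrac (Fin n) (X i₁) ^ (10 * 1) ∈ algebraicOver A := by
    rw [hPeq] at hP0
    rw [← mul_div_cancel_right₀ (toFrac (Fin n) (X i₁) ^ (10 * 1)) (right_ne_zero_of_mul hP0),
      ← hPeq]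
    exact _root_.div_mem (toFrac_mem_algebraicOver (pullForm_mem _))
      (aeval_mem_intermediateField _ hw P)
  have h1 : toFrac (Fin n) (X i₁) ∈ algebraicOver A :=
    IsAlgebraic.of_pow (by norm_num) (mem_algebraicOver.1 hval)
  have h2 : toFrac (Fin n) (X i) ∈ algebraicOver A := by
    rw [← div_mul_cancel₀ (toFrac (Fin n) (X i)) (toFrac_X_ne_zero i₁)]
    exact mul_mem (hw i) h1
  exact (isAlgebraic_algebraMap_iff (toFrac_injective (Fin n))).1 h2

theorem mk_mem_zeroLocus_iff {σ : Type} {G : MvPolynomial σ ℂ} {d : ℕ} (hG : G.IsHomogeneous d)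
    {v : σ → ℂ} (hv : v ≠ 0) : Projectivization.mk ℂ v hv ∈ zeroLocus G ↔ eval v G = 0 := by
  obtain ⟨a, ha⟩ := Projectivization.exists_smul_eq_mk_rep ℂ v hv
  change eval (Projectivization.mk ℂ v hv).rep G = 0 ↔ _
  have ha' : (a : ℂ) • v = (Projectivization.mk ℂ v hv).rep := ha
  rw [← ha', eval_smul_of_isHomogeneous hG, mul_eq_zero, or_iff_right (pow_ne_zero _ a.ne_zero)]

/-- A form vanishes on the image of a rational map only if its pullback is zero. -/
theorem aeval_form_eq_zero {σ τ : Type} (ρ : ProjRatMap σ τ) (hdeg : ρ.deg ≠ 0)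
    {G : MvPolynomial τ ℂ} {d : ℕ} (hG : G.IsHomogeneous d) (h : ρ.image ⊆ zeroLocus G) :
    aeval ρ.form G = 0 := by
  obtain ⟨i, hi⟩ := ρ.exists_ne_zero
  -- Multiplying by a nonzero component restricts the check to points where the map is defined.
  refine (mul_eq_zero.1
    (MvPolynomial.funext fun y => ?_ : aeval ρ.form G * ρ.form i = 0)).resolve_right hi
  rw [map_mul, map_zero, eval_aeval]
  by_cases hy : eval y (ρ.form i) = 0
  · rw [hy, mul_zero]
  have hy0 : y ≠ 0 := fun h0 => hy <| by
    have := eval_smul_of_isHomogeneous (ρ.isHomogeneous i) 0 y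
    rw [zero_smul, zero_pow hdeg, zero_mul] at this
    rw [h0, this]
  obtain ⟨a, ha⟩ := Projectivization.exists_smul_eq_mk_rep ℂ y hy0
  have ha' : (a : ℂ) • y = (Projectivization.mk ℂ y hy0).rep := ha
  have hrep : (fun j => eval (Projectivization.mk ℂ y hy0).rep (ρ.form j)) =
      (a : ℂ) ^ ρ.deg • fun j => eval y (ρ.form j) := by
    ext j
    rw [← ha', eval_smul_of_isHomogeneous (ρ.isHomogeneous j)]
    rfl
  have hne : (fun j => eval (Projectivization.mk ℂ y hy0).rep (ρ.form j)) ≠ 0 := by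
    rw [hrep]
    exact smul_ne_zero (pow_ne_zero _ a.ne_zero) fun h0 => hy (congrFun h0 i)
  have hmem := h ⟨_, hne, rfl⟩
  rw [mk_mem_zeroLocus_iff hG, hrep, eval_smul_of_isHomogeneous hG] at hmem
  rw [(mul_eq_zero.1 hmem).resolve_left (pow_ne_zero _ (pow_ne_zero _ a.ne_zero)), zero_mul]

theorem IsGeneric.aeval_paramForm_eq_zero (h : IsGeneric F B i₀ i₁ x) (hF : F.IsHomogeneous 3) :
    aeval (paramForm F B i₀ i₁) F = 0 := by
  refine MvPolynomial.funext fun y => ?_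
  rw [eval_aeval, eval_residualPt, eval_eq_polar hF, polar_residualPt h.vanish, map_zero]

theorem IsGeneric.isDominantOnto (h : IsGeneric F B i₀ i₁ x) (hF : F.IsHomogeneous 3)
    (hirr : Irreducible F) : h.ratMap.IsDominantOnto (zeroLocus F) := by
  constructor
  · rintro _ ⟨p, hp, rfl⟩
    rw [mk_mem_zeroLocus_iff hF]
    have := congrArg (eval p.rep) (h.aeval_paramForm_eq_zero hF)
    rwa [eval_aeval, map_zero] at this
  · intro p hp d G hG hsub
    obtain ⟨H, rfl⟩ := dvd_of_aeval_eq_zero hirr.prime _ (h.aeval_paramForm_eq_zero hF)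
      h.isAlgebraic_X G (aeval_form_eq_zero h.ratMap (by decide : (10 : ℕ) ≠ 0) hG hsub)
    have hp' : eval p.rep F = 0 := hp
    change eval p.rep (F * H) = 0
    rw [map_mul, hp', zero_mul]

/-- The four coefficients of a binary cubic form are determined by its values at `(1, 0)`, `(0, 1)`,
`(1, 1)` and `(1, -1)`. -/
theorem vanishesOn_of_forall {V : Type*} [AddCommGroup V] [Module ℂ V]
    {T : V →ₗ[ℂ] V →ₗ[ℂ] V →ₗ[ℂ] ℂ} (hT : IsSymm₃ T) {p q : V}
    (h : ∀ a b : ℂ, T (a • p + b • q) (a • p + b • q) (a • p + b • q) = 0) : VanishesOn T p q := by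
  have h1 := h 1 0
  have h2 := h 0 1
  have h3 := h 1 1
  have h4 := h 1 (-1)
  rw [hT.cube_add] at h1 h2 h3 h4
  constructor
  · linear_combination h1
  · linear_combination (1 / 6) * h3 - (1 / 6) * h4 - (1 / 3) * h2
  · linear_combination (1 / 6) * h3 + (1 / 6) * h4 - (1 / 3) * h1
  · linear_combination h2

end Dominance
end CubicUnirational

end

/-! ### The theorem -/

open CubicUnirational in
/-- A smooth cubic hypersurface `X ⊆ ℙⁿ` containing a line is dominated by a rational map of degree
two from `ℙⁿ⁻¹`, the projective space with `n` homogeneous coordinates. -/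
theorem mainTheorem8 {n : ℕ} (X L : Set (ℙ ℂ (Fin (n + 1) → ℂ)))
    (hX : IsSmoothCubic X) (hL : IsLine L) (hLX : L ⊆ X) :
    ∃ ρ : ProjRatMap (Fin n) (Fin (n + 1)), ρ.IsDominantOnto X ∧ ρ.degree = 2 := by
  classical
  obtain ⟨F, hF, rfl, hsm⟩ := hX
  obtain ⟨W, hW, rfl⟩ := hL
  have hsm' : ∀ x : Fin (n + 1) → ℂ, x ≠ 0 → MvPolynomial.eval x F = 0 →
      ∃ i, MvPolynomial.eval x (MvPolynomial.pderiv i F) ≠ 0 := fun x hx hx0 => by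
    obtain ⟨i, hi⟩ := hsm (Projectivization.mk ℂ x hx) ((mk_mem_zeroLocus_iff hF hx).2 hx0)
    exact ⟨i, fun h0 => hi ((mk_mem_zeroLocus_iff hF.pderiv hx).2 h0)⟩
  have hs : IsSmooth₃ (polar F ℂ) := fun x hx hx0 => by
    obtain ⟨i, hi⟩ := hsm' x hx (by rw [eval_eq_polar hF, hx0])
    rw [eval_pderiv_eq_polar hF] at hi
    exact ⟨_, right_ne_zero_of_mul hi⟩
  have hWF : ∀ w ∈ W, polar F ℂ w w w = 0 := fun w hw => by
    by_cases hw0 : w = 0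
    · rw [hw0, map_zero]
    · rw [← eval_eq_polar hF, ← mk_mem_zeroLocus_iff hF hw0]
      refine hLX ?_
      change Projectivization.submodule _ ≤ W
      rw [Projectivization.submodule_mk, Submodule.span_singleton_le_iff_mem]
      exact hw
  let b := Module.finBasisOfFinrankEq ℂ W hW
  have hb : LinearIndependent ℂ ![(b 0 : Fin (n + 1) → ℂ), (b 1 : Fin (n + 1) → ℂ)] := by
    have h1 := b.linearIndependent.map' W.subtype W.ker_subtype
    have h2 : ![(b 0 : Fin (n + 1) → ℂ), (b 1 : Fin (n + 1) → ℂ)] = W.subtype ∘ b := by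
      ext i : 1
      fin_cases i <;> rfl
    rw [h2]
    exact h1
  obtain ⟨B, i₀, i₁, x, h⟩ := exists_isGeneric hs hb
    (vanishesOn_of_forall isSymm₃_polar fun a c => hWF _
      (W.add_mem (W.smul_mem _ (b 0).2) (W.smul_mem _ (b 1).2)))
  -- The distinct indices `i₀`, `i₁` in `Fin n` force `n ≥ 2`.
  have hn : 3 ≤ Fintype.card (Fin (n + 1)) := by
    have := Fin.isLt i₀
    have := Fin.isLt i₁
    have := Fin.val_ne_of_ne h.ne
    rw [Fintype.card_fin]
    omega
  have hF0 : F ≠ 0 := by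
    rintro rfl
    obtain ⟨i, hi⟩ := hsm' (b 0 : Fin (n + 1) → ℂ) (hb.ne_zero 0) (by simp)
    simp at hi
  exact ⟨h.ratMap, h.isDominantOnto hF (irreducible_of_smooth hn hF hF0 hsm'), h.degree_ratMap⟩
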